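/- Let $\log$ denote the natural logarithm. For $\varepsilon_1>0$, $k>0$ put $\varepsilon(x,\varepsilon_1,k)=0$ if $x<k/5$ and $\varepsilon(x,\varepsilon_1,k)=\varepsilon_1/\log^2(15x/k)$ if $x\ge k/5$. For a finite simple graph $G$ and $X\subseteq V(G)$, let $N_G(X)$ be the set of vertices of $V(G)\setminus X$ that have a neighbour in $X$. The graph $G$ is an $(\varepsilon_1,k)$-expander if $|N_G(X)|\ge \varepsilon(|X|,\varepsilon_1,k)\,|X|$ for every $X\subseteq V(G)$ with $k/2\le |X|\le |V(G)|/2$. For an integer $\ell\ge 0$, an $\ell$-wheel is a graph obtained from a cycle (of length at least $3$) by replacing $\ell$ of its edges with $\ell$ cycles: each of these edges $uv$ is replaced by a cycle of length at least $3$ through $u$ and $v$ all of whose other vertices are new, and the new vertices of different cycles are distinct. Lemma 2.7. For every $0<\varepsilon_1<1$ there is an $n_0$ such that for every $n\ge n_0$, every $(\varepsilon_1,15)$-expander $H$ on $n$ vertices contains, as a subgraph, an $\ell$-wheel for some $$\ell\ \ge\ \Big(\frac{\varepsilon_1}{20}\Big)^{16}\cdot\frac{2n}{\log^{16} n}.$$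 -/

import Mathlib

noncomputable section

namespace SublinearExpander

/-- The expansion function `ε(x, ε₁, k)`, with `log` the natural logarithm. -/
def expansion (ε₁ k x : ℝ) : ℝ :=
  open Classical in if x < k / 5 then 0 else ε₁ / Real.log (15 * x / k) ^ 2

/-- The external neighbourhood `N_G(X)`: the vertices outside `X` that have a neighbour in `X`. -/
def extNbhd {V : Type*} [Fintype V] (G : SimpleGraph V) (X : Finset V) : Finset V :=
  open Classical in Finset.univ.filter (fun v => v ∉ X ∧ ∃ u ∈ X, G.Adj u v)

/-- `G` is an `(ε₁, k)`-expander: `|N_G(X)| ≥ ε(|X|) · |X|` for every set `X` of vertices with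
`k / 2 ≤ |X| ≤ |V(G)| / 2`. -/
def IsExpander {V : Type*} [Fintype V] (G : SimpleGraph V) (ε₁ k : ℝ) : Prop :=
  ∀ X : Finset V, k / 2 ≤ (X.card : ℝ) → (X.card : ℝ) ≤ (Fintype.card V : ℝ) / 2 →
    expansion ε₁ k (X.card : ℝ) * (X.card : ℝ) ≤ ((extNbhd G X).card : ℝ)

/-- A subgraph is a (simple) cycle. -/
def IsCycleSubgraph {V : Type*} {G : SimpleGraph V} (C : G.Subgraph) : Prop :=
  ∃ (u : V) (c : G.Walk u u), c.IsCycle ∧ C = c.toSubgraph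

/-- The subgraph `W` of `G` is an `ℓ`-wheel: it arises from a cycle `v 0, v 1, …, v (m - 1)`
of length `m ≥ 3` by replacing `ℓ` of its edges with cycles.

The `i`-th edge of the base cycle joins `v i` to `v (i + 1)`, with indices modulo `m`, and `S` is
the set of the (indices of the) `ℓ` edges that are replaced. The piece `P i` of `W` is that edge
itself if `i ∉ S`, and a cycle through its two ends if `i ∈ S`. Different pieces meet only in the
common ends of the two base edges that they stem from. -/
def IsWheel {V : Type*} {G : SimpleGraph V} (W : G.Subgraph) (ℓ : ℕ) : Prop :=
  ∃ (m : ℕ) (v : ZMod m → V) (S : Finset (ZMod m)) (P : ZMod m → G.Subgraph),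
    3 ≤ m ∧ Function.Injective v ∧ S.card = ℓ ∧
    (∀ i, i ∉ S → ∃ h : G.Adj (v i) (v (i + 1)), P i = G.subgraphOfAdj h) ∧
    (∀ i, i ∈ S → IsCycleSubgraph (P i) ∧ v i ∈ (P i).verts ∧ v (i + 1) ∈ (P i).verts) ∧
    (∀ i j, i ≠ j →
      (P i).verts ∩ (P j).verts ⊆ ({v i, v (i + 1)} : Set V) ∩ {v j, v (j + 1)}) ∧
    W = ⨆ i, P i

end SublinearExpander

end

/-!
Apart from the logarithm, only the following is used of the expander: every set of at least `8` and
at most half of the vertices expands by the factor `δ = ε₁ / log² n`. Hence two large sets are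
linked by a path of length `O(log n / δ)`, even after the deletion of a few vertices.

The complement of any small set contains a cycle whose length is at least `s` and polynomial in
`log n / δ`: delete also a largest nonexpanding set, find a long path by depth-first search and
close a window of it by a short link. A maximal family of disjoint cycles of this kind therefore
covers `δ² n / 48` vertices.

A second depth-first search runs over these cycles and steps from a cycle to an unvisited one along
a short link. When a third of the covered vertices is finished, only the vertices of the links and
of the stack separate these from the unvisited cycles. There are few links, since the cycles are
long and hence few, so expansion forces the stack to be large: it is a chain of cycles. Finally
a short link between the two ends of the chain that avoids its middle part closes the middle part
to a wheel.
-/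

namespace SublinearExpander

open scoped Classical

section Linked

variable {V : Type*} {G : SimpleGraph V} {R C : Set V} {l : ℕ} {x y z : V}

/-- The vertices `x` and `y` are joined by a walk of length at most `l` all of whose vertices,
including the ends, lie in `R`. -/
def Linked (G : SimpleGraph V) (R : Set V) (l : ℕ) (x y : V) : Prop :=
  ∃ w : G.Walk x y, w.length ≤ l ∧ ∀ v ∈ w.support, v ∈ R

namespace Linked

theorem refl (hx : x ∈ R) : Linked G R l x x :=
  ⟨.nil, Nat.zero_le l, by simpa using hx⟩

theorem of_adj (h : G.Adj x y) (hx : x ∈ R) (hy : y ∈ R) : Linked G R 1 x y :=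
  ⟨h.toWalk, by simp, by simp [hx, hy]⟩

theorem left_mem (h : Linked G R l x y) : x ∈ R :=
  let ⟨w, _, hw⟩ := h
  hw x w.start_mem_support

theorem right_mem (h : Linked G R l x y) : y ∈ R :=
  let ⟨w, _, hw⟩ := h
  hw y w.end_mem_support

theorem symm (h : Linked G R l x y) : Linked G R l y x :=
  let ⟨w, hl, hw⟩ := h
  ⟨w.reverse, by simpa using hl, by simpa using hw⟩

theorem trans {l' : ℕ} (h : Linked G R l x y) (h' : Linked G R l' y z) :
    Linked G R (l + l') x z := by
  obtain ⟨w, hl, hw⟩ := h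
  obtain ⟨w', hl', hw'⟩ := h'
  refine ⟨w.append w', by simpa using Nat.add_le_add hl hl', fun v hv => ?_⟩
  exact ((SimpleGraph.Walk.mem_support_append_iff _ _).1 hv).elim (hw v) (hw' v)

theorem mono {R' : Set V} (h : Linked G R l x y) (hR : R ⊆ R') : Linked G R' l x y :=
  let ⟨w, hl, hw⟩ := h
  ⟨w, hl, fun v hv => hR (hw v hv)⟩

theorem mono_length {l' : ℕ} (h : Linked G R l x y) (hl : l ≤ l') : Linked G R l' x y :=
  let ⟨w, hw, hwR⟩ := h
  ⟨w, hw.trans hl, hwR⟩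

theorem exists_isPath (h : Linked G R l x y) :
    ∃ p : G.Walk x y, p.IsPath ∧ p.length ≤ l ∧ ∀ v ∈ p.support, v ∈ R :=
  let ⟨w, hl, hw⟩ := h
  ⟨w.bypass, w.bypass_isPath, w.length_bypass_le_length.trans hl,
    fun v hv => hw v (w.support_bypass_subset_support hv)⟩

theorem avoids_or_hits (h : Linked G R l x y) (C : Set V) :
    Linked G (R \ C) l x y ∨ ∃ c ∈ C, Linked G (insert c (R \ C)) l x c := by
  obtain ⟨w, hl, hw⟩ := h
  induction w generalizing l with
  | @nil u =>
    by_cases hu : u ∈ C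
    · exact .inr ⟨u, hu, refl (Set.mem_insert _ _)⟩
    · exact .inl (refl ⟨by simpa using hw, hu⟩)
  | @cons u v _ huv q ih =>
    by_cases hu : u ∈ C
    · exact .inr ⟨u, hu, refl (Set.mem_insert _ _)⟩
    have huR : u ∈ R \ C := ⟨hw u (by simp), hu⟩
    obtain ⟨k, rfl⟩ : ∃ k, l = 1 + k := ⟨l - 1, by rw [SimpleGraph.Walk.length_cons] at hl; omega⟩
    have hq : q.length ≤ k := by rw [SimpleGraph.Walk.length_cons] at hl; omega
    rcases ih hq fun a ha => hw a (by simp [ha]) with h | ⟨c, hc, h⟩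
    · exact .inl ((of_adj huv huR h.left_mem).trans h)
    · exact .inr ⟨c, hc, (of_adj huv (.inr huR) h.left_mem).trans h⟩

theorem exists_first_hit (h : Linked G R l x y) (hy : y ∈ C) :
    ∃ c ∈ C, Linked G (insert c (R \ C)) l x c :=
  (h.avoids_or_hits C).resolve_left fun h' => h'.right_mem.2 hy

/-- Take the last vertex in `A` and then the first vertex in `B`. -/
theorem exists_crossing {A B : Set V} (h : Linked G R l x y) (hx : x ∈ A) (hy : y ∈ B) :
    ∃ a ∈ A, ∃ b ∈ B, Linked G (insert a (insert b (R \ B) \ A)) l a b :=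
  let ⟨b, hb, h₁⟩ := h.exists_first_hit hy
  let ⟨a, ha, h₂⟩ := h₁.symm.exists_first_hit hx
  ⟨a, ha, b, hb, h₂.symm⟩

end Linked

end Linked

section Necklace

variable {V : Type*} {G : SimpleGraph V} {t : Bool} {Q : G.Subgraph} {a b c x y : V}
  {S T : Finset V} {ℓ k : ℕ}

/-- A piece of a wheel with ends `x` and `y`: a cycle through both of them (kind `true`) or an
edge between them (kind `false`). -/
def IsPiece : Bool → G.Subgraph → V → V → Prop
  | true, Q, x, y => x ≠ y ∧ IsCycleSubgraph Q ∧ x ∈ Q.verts ∧ y ∈ Q.verts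
  | false, Q, x, y => ∃ h : G.Adj x y, Q = G.subgraphOfAdj h

namespace IsPiece

theorem ne (h : IsPiece t Q x y) : x ≠ y := by
  cases t
  · exact h.1.ne
  · exact h.1

theorem left_mem (h : IsPiece t Q x y) : x ∈ Q.verts := by
  cases t
  · obtain ⟨h, rfl⟩ := h
    simp
  · exact h.2.2.1

theorem right_mem (h : IsPiece t Q x y) : y ∈ Q.verts := by
  cases t
  · obtain ⟨h, rfl⟩ := h
    simp
  · exact h.2.2.2

theorem connected (h : IsPiece t Q x y) : Q.Connected := by
  cases t
  · obtain ⟨h, rfl⟩ := h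
    exact SimpleGraph.Subgraph.subgraphOfAdj_connected h
  · obtain ⟨-, ⟨u, c, -, rfl⟩, -⟩ := h
    exact c.toSubgraph_connected

theorem exists_linked {u v : V} (h : IsPiece t Q x y) (hu : u ∈ Q.verts) (hv : v ∈ Q.verts) :
    ∃ l, Linked G Q.verts l u v := by
  obtain ⟨w, hw⟩ := (Q.connected_iff_forall_exists_walk_subgraph.1 h.connected).2 hu hv
  exact ⟨_, w, le_rfl, fun z hz => hw.1 (w.mem_verts_toSubgraph.2 hz)⟩

end IsPiece

/-- `Necklace G a b S ℓ`: a chain of pieces leads from `a` to `b`, consecutive pieces share exactly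
their common end and other pieces are disjoint; `S` is the set of all vertices and `ℓ` the number
of cycles among the pieces. -/
inductive Necklace (G : SimpleGraph V) (a : V) : V → Finset V → ℕ → Prop
  | nil : Necklace G a a {a} 0
  | snoc {b c : V} {S T : Finset V} {ℓ : ℕ} {t : Bool} {Q : G.Subgraph} :
      Necklace G a b S ℓ → IsPiece t Q b c → (T : Set V) = Q.verts → S ∩ T = {b} →
      Necklace G a c (S ∪ T) (ℓ + t.toNat)

namespace Necklace

theorem left_mem (h : Necklace G a b S ℓ) : a ∈ S := by
  induction h with
  | nil => simp
  | snoc _ _ _ _ ih => exact Finset.mem_union_left _ ih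

theorem right_mem (h : Necklace G a b S ℓ) : b ∈ S := by
  cases h with
  | nil => simp
  | snoc _ hQ hT _ =>
    exact Finset.mem_union_right _ (Finset.mem_coe.1 (hT ▸ hQ.right_mem))

theorem append (h : Necklace G a b S ℓ) (h' : Necklace G b c T k) (hST : S ∩ T = {b}) :
    Necklace G a c (S ∪ T) (ℓ + k) := by
  induction h' with
  | nil => simpa [h.right_mem] using h
  | @snoc d e T U j t Q h₁ hQ hU hTU ih =>
    have hST' : S ∩ T = {b} := by
      refine Finset.Subset.antisymm (fun v hv => ?_)
        (by simpa using ⟨h.right_mem, h₁.left_mem⟩)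
      rw [Finset.mem_inter] at hv
      rw [← hST]
      simp [hv]
    have hd : d ∈ T := h₁.right_mem
    have hSTU : (S ∪ T) ∩ U = {d} := by
      have key : ∀ v, v ∈ S → v ∈ U → v ∈ T := fun v hvS hvU => by
        have : v ∈ S ∩ (T ∪ U) := by simp [hvS, hvU]
        rw [hST, Finset.mem_singleton] at this
        exact this ▸ h₁.left_mem
      rw [← hTU]
      grind
    simpa [Finset.union_assoc, add_assoc] using (ih hST').snoc hQ hU hSTU

theorem of_isPath {p : G.Walk x y} (hp : p.IsPath) : Necklace G y x p.support.toFinset 0 := by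
  induction p with
  | nil => simpa using nil
  | @cons u v w huv q ih =>
    rw [SimpleGraph.Walk.cons_isPath_iff] at hp
    have hpiece : IsPiece false (G.subgraphOfAdj huv.symm) v u := ⟨huv.symm, rfl⟩
    have hv := q.start_mem_support
    have hcap : q.support.toFinset ∩ {v, u} = {v} := by
      ext z
      simp only [Finset.mem_inter, List.mem_toFinset, Finset.mem_insert, Finset.mem_singleton]
      grind
    have hcup : (SimpleGraph.Walk.cons huv q).support.toFinset = q.support.toFinset ∪ {v, u} := by
      ext z
      simp only [SimpleGraph.Walk.support_cons, List.mem_toFinset, List.mem_cons,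
        Finset.mem_union, Finset.mem_insert, Finset.mem_singleton]
      grind
    exact hcup ▸ (ih hp.1).snoc hpiece (by simp) hcap

theorem exists_linked_right (h : Necklace G a b S ℓ) (hx : x ∈ S) : ∃ l, Linked G S l x b := by
  induction h with
  | nil => exact ⟨0, by simp_all [Linked.refl]⟩
  | @snoc b c _ _ _ _ _ _ hQ hT _ ih =>
    rw [Finset.coe_union, hT]
    rcases Finset.mem_union.1 hx with hx | hx
    · obtain ⟨l, hl⟩ := ih hx
      obtain ⟨l', hl'⟩ := hQ.exists_linked hQ.left_mem hQ.right_mem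
      exact ⟨l + l', (hl.mono Set.subset_union_left).trans (hl'.mono Set.subset_union_right)⟩
    · obtain ⟨l, hl⟩ := hQ.exists_linked (hT ▸ Finset.mem_coe.2 hx) hQ.right_mem
      exact ⟨l, hl.mono Set.subset_union_right⟩

theorem exists_linked (h : Necklace G a b S ℓ) (hx : x ∈ S) (hy : y ∈ S) :
    ∃ l, Linked G S l x y :=
  let ⟨_, hx'⟩ := h.exists_linked_right hx
  let ⟨_, hy'⟩ := h.exists_linked_right hy
  ⟨_, hx'.trans hy'.symm⟩

end Necklace

end Necklace

section Wheel

variable {V : Type*} {G : SimpleGraph V} {a b : V} {S : Finset V} {ℓ k : ℕ}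

/-- An enumeration in order of the pieces of a necklace with vertex set `S` and `ℓ` cycles; the
piece `P i` has the ends `v i` and `v (i + 1)`. -/
structure IsPieceSeq (S : Finset V) (ℓ : ℕ) (v : Fin (k + 1) → V) (P : Fin k → G.Subgraph)
    (kind : Fin k → Bool) : Prop where
  isPiece : ∀ i, IsPiece (kind i) (P i) (v i.castSucc) (v i.succ)
  sum_kind : ∑ i, (kind i).toNat = ℓ
  mem : ∀ i, v i ∈ S
  subset : ∀ i, (P i).verts ⊆ S
  eq_of_mem : ∀ i j, i < j → ∀ x ∈ (P i).verts, x ∈ (P j).verts →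
    i.succ = j.castSucc ∧ x = v j.castSucc

namespace IsPieceSeq

variable {v : Fin (k + 1) → V} {P : Fin k → G.Subgraph} {kind : Fin k → Bool}

theorem injective (hP : IsPieceSeq S ℓ v P kind) : Function.Injective v := by
  refine Function.Injective.of_lt_imp_ne fun i j => ?_
  refine Fin.cases (by simp) (fun j => ?_) j
  refine Fin.lastCases (fun h => absurd (Fin.le_last j.succ) h.not_ge) (fun i hij heq => ?_) i
  rcases (Fin.castSucc_lt_succ_iff.1 hij).eq_or_lt with rfl | hlt
  · exact (hP.isPiece i).ne heq
  · have := (hP.eq_of_mem i j hlt _ (hP.isPiece i).left_mem (heq ▸ (hP.isPiece j).right_mem)).2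
    exact (hP.isPiece j).ne (this.symm.trans heq)

theorem eq_of_vertex_mem (hP : IsPieceSeq S ℓ v P kind) {i : Fin k} {j : Fin (k + 1)}
    (h : v j ∈ (P i).verts) : j = i.castSucc ∨ j = i.succ := by
  revert h
  refine Fin.cases (fun h => ?_) (fun j h => ?_) j
  · cases k with
    | zero => exact i.elim0
    | succ k =>
      rcases (Fin.zero_le i).eq_or_lt with rfl | hi
      · exact .inl rfl
      · exact .inl (hP.injective (hP.eq_of_mem 0 i hi _ (hP.isPiece 0).left_mem h).2)
  · rcases lt_trichotomy i j with hij | rfl | hij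
    · exact absurd (hP.eq_of_mem i j hij _ h (hP.isPiece j).right_mem).2.symm (hP.isPiece j).ne
    · exact .inr rfl
    · exact .inl (hP.injective (hP.eq_of_mem j i hij _ (hP.isPiece j).right_mem h).2)

end IsPieceSeq

theorem Necklace.exists_isPieceSeq (h : Necklace G a b S ℓ) :
    ∃ (k : ℕ) (v : Fin (k + 1) → V) (P : Fin k → G.Subgraph) (kind : Fin k → Bool),
      v 0 = a ∧ v (Fin.last k) = b ∧ IsPieceSeq S ℓ v P kind := by
  induction h with
  | nil => exact ⟨0, fun _ => a, Fin.elim0, Fin.elim0, rfl, rfl, by constructor <;> simp⟩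
  | @snoc b c S T ℓ t Q _ hQ hT hST ih =>
    obtain ⟨k, v, P, kind, h0, hk, hP⟩ := ih
    refine ⟨k + 1, Fin.snoc v c, Fin.snoc P Q, Fin.snoc kind t, ?_, by simp, ?_, ?_, ?_, ?_, ?_⟩
    · rw [← Fin.castSucc_zero, Fin.snoc_castSucc, h0]
    · refine Fin.lastCases (by simpa [hk] using hQ) fun i => ?_
      simpa [-Fin.castSucc_succ, ← Fin.castSucc_succ] using hP.isPiece i
    · simp [Fin.sum_univ_castSucc, hP.sum_kind]
    · refine Fin.lastCases ?_ fun i => ?_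
      · simpa using .inr (Finset.mem_coe.1 (hT ▸ hQ.right_mem))
      · simpa using .inl (hP.mem i)
    · refine Fin.lastCases ?_ fun i => ?_
      · simp [← hT]
      · simpa using (hP.subset i).trans Set.subset_union_left
    · intro i j hij x
      induction i using Fin.lastCases with
      | last => exact absurd (Fin.le_last j) hij.not_ge
      | cast i =>
        induction j using Fin.lastCases with
        | cast j =>
          simp only [Fin.snoc_castSucc, Fin.succ_castSucc, Fin.castSucc_inj]
          exact hP.eq_of_mem i j hij x
        | last =>
          simp only [Fin.snoc_castSucc, Fin.snoc_last, Fin.succ_castSucc, Fin.castSucc_inj, hk]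
          intro hxi hxQ
          rw [← hT] at hxQ
          obtain rfl : x = b := by
            rw [← Finset.mem_singleton, ← hST]
            exact Finset.mem_inter.2 ⟨hP.subset i hxi, hxQ⟩
          subst hk
          refine ⟨?_, rfl⟩
          exact ((hP.eq_of_vertex_mem hxi).resolve_left (Fin.castSucc_lt_last i).ne').symm

theorem IsWheel.of_fin {v : Fin (k + 1) → V} {P : Fin (k + 1) → G.Subgraph}
    {kind : Fin (k + 1) → Bool} (hk : 2 ≤ k) (hv : Function.Injective v)
    (hP : ∀ i, IsPiece (kind i) (P i) (v i) (v (i + 1)))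
    (hcap : ∀ i j, i < j → ∀ x ∈ (P i).verts, x ∈ (P j).verts →
      (x = v i ∨ x = v (i + 1)) ∧ (x = v j ∨ x = v (j + 1))) :
    IsWheel (⨆ i, P i) (∑ i, (kind i).toNat) := by
  refine ⟨k + 1, v, Finset.univ.filter (kind · = true), P, by omega, hv, ?_, fun i hi => ?_,
    fun i hi => ?_, fun (i j : Fin (k + 1)) hij x ⟨hxi, hxj⟩ => ?_, rfl⟩
  · rw [Finset.card_filter]
    exact Finset.sum_congr rfl fun i _ => by cases kind i <;> simp
  · have := hP i
    rwa [show kind i = false by simpa using hi] at this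
  · have := hP i
    rw [show kind i = true by simpa using hi] at this
    exact this.2
  · rcases lt_or_gt_of_ne (α := Fin (k + 1)) hij with h | h
    · exact hcap i j h x hxi hxj
    · exact (hcap j i h x hxj hxi).symm

theorem IsPieceSeq.exists_isWheel {v : Fin (k + 1) → V} {P : Fin k → G.Subgraph}
    {kind : Fin k → Bool} (hP : IsPieceSeq S ℓ v P kind) (hℓ : 2 ≤ ℓ)
    (h : G.Adj (v (Fin.last k)) (v 0)) : ∃ W : G.Subgraph, IsWheel W ℓ := by
  have hk : 2 ≤ k := by
    have : ∑ i, (kind i).toNat ≤ ∑ _ : Fin k, 1 := Finset.sum_le_sum fun i _ => Bool.toNat_le _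
    simp only [hP.sum_kind, Finset.sum_const, Finset.card_univ, Fintype.card_fin, smul_eq_mul,
      mul_one] at this
    omega
  let P' : Fin (k + 1) → G.Subgraph := Fin.snoc P (G.subgraphOfAdj h)
  let kind' : Fin (k + 1) → Bool := Fin.snoc kind false
  have hsum : ∑ i, (kind' i).toNat = ℓ := by simp [kind', Fin.sum_univ_castSucc, hP.sum_kind]
  refine ⟨⨆ i, P' i, hsum ▸
    IsWheel.of_fin (v := v) hk hP.injective (fun i => ?_) fun i j hij x => ?_⟩
  · induction i using Fin.lastCases with
    | last => simpa [P', kind'] using ⟨h, rfl⟩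
    | cast i => simpa [P', kind', Fin.coeSucc_eq_succ] using hP.isPiece i
  induction i using Fin.lastCases with
  | last => exact absurd (Fin.le_last j) hij.not_ge
  | cast i =>
    induction j using Fin.lastCases with
    | cast j =>
      simp only [P', Fin.snoc_castSucc, Fin.coeSucc_eq_succ]
      intro hxi hxj
      obtain ⟨hij', rfl⟩ := hP.eq_of_mem i j hij x hxi hxj
      exact ⟨.inr (by rw [hij']), .inl rfl⟩
    | last =>
      simp only [P', Fin.snoc_castSucc, Fin.snoc_last, Fin.coeSucc_eq_succ, Fin.last_add_one]
      rintro hxi (rfl | rfl)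
      · exact ⟨(hP.eq_of_vertex_mem hxi).imp (congrArg v) (congrArg v), .inl rfl⟩
      · exact ⟨(hP.eq_of_vertex_mem hxi).imp (congrArg v) (congrArg v), .inr rfl⟩

theorem Necklace.exists_isWheel_of_adj (h : Necklace G a b S ℓ) (hℓ : 2 ≤ ℓ) (hba : G.Adj b a) :
    ∃ W : G.Subgraph, IsWheel W ℓ := by
  obtain ⟨k, v, P, kind, rfl, rfl, hP⟩ := h.exists_isPieceSeq
  exact hP.exists_isWheel hℓ hba

theorem Necklace.ne (h : Necklace G a b S ℓ) (hℓ : ℓ ≠ 0) : a ≠ b := by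
  obtain ⟨k, v, P, kind, rfl, rfl, hP⟩ := h.exists_isPieceSeq
  intro h0
  obtain rfl : k = 0 := by simpa [Fin.ext_iff, eq_comm] using hP.injective h0
  exact hℓ (by simp [← hP.sum_kind])

theorem Necklace.exists_isWheel_of_linked {l : ℕ} (h : Necklace G a b S ℓ) (hℓ : 2 ≤ ℓ)
    (hl : Linked G {v | v ∈ S → v = a ∨ v = b} l a b) :
    ∃ W : G.Subgraph, IsWheel W ℓ := by
  obtain ⟨p, hp, -, hpS⟩ := hl.exists_isPath
  cases p with
  | nil => exact absurd rfl (h.ne (by omega))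
  | @cons _ u _ hau q =>
    rw [SimpleGraph.Walk.cons_isPath_iff] at hp
    have hcap : S ∩ q.support.toFinset = {b} := by
      have hb := h.right_mem
      have hb' := q.end_mem_support
      ext v
      have := hpS v
      simp only [Set.mem_ofPred_eq, SimpleGraph.Walk.support_cons, List.mem_cons] at this
      simp only [Finset.mem_inter, List.mem_toFinset, Finset.mem_singleton]
      grind
    exact (h.append (.of_isPath hp.1) hcap).exists_isWheel_of_adj hℓ hau.symm

theorem Necklace.exists_isWheel_of_bypass {c d u v : V} {S₁ S₂ S₃ : Finset V} {ℓ₁ ℓ₂ ℓ₃ l : ℕ}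
    (h₁ : Necklace G a c S₁ ℓ₁) (h₂ : Necklace G c d S₂ ℓ₂) (h₃ : Necklace G d b S₃ ℓ₃)
    (h₁₂ : S₁ ∩ S₂ = {c}) (h₂₃ : S₂ ∩ S₃ = {d}) (hℓ : 2 ≤ ℓ₂) (hu : u ∈ S₁) (hv : v ∈ S₃)
    (huv : Linked G (S₂ : Set V)ᶜ l u v) : ∃ W : G.Subgraph, IsWheel W ℓ₂ := by
  obtain ⟨l₁, hcu⟩ := h₁.exists_linked h₁.right_mem hu
  obtain ⟨l₃, hvd⟩ := h₃.exists_linked hv h₃.left_mem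
  let R : Set V := {x | x ∈ S₂ → x = c ∨ x = d}
  have hR₁ : (S₁ : Set V) ⊆ R := fun x hx hx₂ =>
    .inl (Finset.mem_singleton.1 (h₁₂ ▸ Finset.mem_inter.2 ⟨hx, hx₂⟩))
  have hR₃ : (S₃ : Set V) ⊆ R := fun x hx hx₂ =>
    .inr (Finset.mem_singleton.1 (h₂₃ ▸ Finset.mem_inter.2 ⟨hx₂, hx⟩))
  have hR₂ : (S₂ : Set V)ᶜ ⊆ R := fun x hx hx₂ => absurd hx₂ hx
  exact h₂.exists_isWheel_of_linked hℓ (((hcu.mono hR₁).trans (huv.mono hR₂)).trans (hvd.mono hR₃))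

end Wheel

section BeadChain

variable {V : Type*} {G : SimpleGraph V} {a b : V} {S : Finset V} {ℓ K : ℕ}

/-- A necklace put together from `ℓ` segments, each of which contains exactly one cycle and adds at
most `K` vertices. -/
inductive BeadChain (G : SimpleGraph V) (K : ℕ) (a : V) : V → Finset V → ℕ → Prop
  | nil : BeadChain G K a a {a} 0
  | snoc {b c : V} {S T : Finset V} {ℓ : ℕ} : BeadChain G K a b S ℓ → Necklace G b c T 1 →
      T.card ≤ K + 1 → S ∩ T = {b} → BeadChain G K a c (S ∪ T) (ℓ + 1)

namespace BeadChain

theorem necklace (h : BeadChain G K a b S ℓ) : Necklace G a b S ℓ := by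
  induction h with
  | nil => exact .nil
  | snoc _ hT _ hST ih => exact ih.append hT hST

theorem card_union_le {S T : Finset V} (hST : S ∩ T = {b}) (hT : T.card ≤ K + 1) :
    (S ∪ T).card ≤ S.card + K := by
  have := Finset.card_union_add_card_inter S T
  rw [hST, Finset.card_singleton] at this
  omega

theorem card_le (h : BeadChain G K a b S ℓ) : S.card ≤ ℓ * K + 1 := by
  induction h with
  | nil => simp
  | snoc _ _ hT hST ih => linarith [card_union_le hST hT, Nat.succ_mul (n := ‹ℕ›) K]

theorem exists_split {θ : ℕ} (h : BeadChain G K a b S ℓ) (hθ : 1 ≤ θ) (hS : θ ≤ S.card) :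
    ∃ (m : V) (S₁ S₂ : Finset V) (ℓ₁ ℓ₂ : ℕ), BeadChain G K a m S₁ ℓ₁ ∧ BeadChain G K m b S₂ ℓ₂ ∧
      S₁ ∩ S₂ = {m} ∧ S₁ ∪ S₂ = S ∧ θ ≤ S₁.card ∧ S₁.card ≤ θ + K := by
  induction h with
  | nil =>
    exact ⟨a, {a}, {a}, 0, 0, .nil, .nil, by simp, by simp, hS, by simp; omega⟩
  | @snoc b c S T ℓ h hT hTK hST ih =>
    by_cases hθS : θ ≤ S.card
    · obtain ⟨m, S₁, S₂, ℓ₁, ℓ₂, h₁, h₂, hcap, rfl, hlo, hhi⟩ := ih hθS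
      have hb : b ∈ S₂ := h₂.necklace.right_mem
      have hS₂T : S₂ ∩ T = {b} := by grind
      have hcap' : S₁ ∩ (S₂ ∪ T) = {m} := by
        simp only [Finset.ext_iff, Finset.mem_inter, Finset.mem_union,
          Finset.mem_singleton] at hST hcap ⊢
        grind
      exact ⟨m, S₁, S₂ ∪ T, ℓ₁, ℓ₂ + 1, h₁, h₂.snoc hT hTK hS₂T, hcap',
        (Finset.union_assoc _ _ _).symm, hlo, hhi⟩
    · have hc : c ∈ S ∪ T := Finset.mem_union_right _ hT.right_mem
      have := card_union_le hST hTK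
      exact ⟨c, S ∪ T, {c}, ℓ + 1, 0, h.snoc hT hTK hST, .nil, by simpa using hc,
        by simpa using hc, hS, by omega⟩

theorem exists_split_three {θ₁ θ₂ : ℕ} (h : BeadChain G K a b S ℓ) (h₁ : 1 ≤ θ₁) (h₂ : 1 ≤ θ₂)
    (hS : 2 * θ₁ + θ₂ + 2 * K ≤ S.card) :
    ∃ (c d : V) (S₁ S₂ S₃ : Finset V) (ℓ₁ ℓ₂ ℓ₃ : ℕ), BeadChain G K a c S₁ ℓ₁ ∧
      BeadChain G K c d S₂ ℓ₂ ∧ BeadChain G K d b S₃ ℓ₃ ∧ S₁ ∩ S₂ = {c} ∧ S₂ ∩ S₃ = {d} ∧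
      θ₁ ≤ S₁.card ∧ θ₂ ≤ S₂.card ∧ S₂.card ≤ θ₂ + K ∧ θ₁ ≤ S₃.card := by
  obtain ⟨c, S₁, S', ℓ₁, ℓ', hc₁, hc', hcap, hcup, hlo, hhi⟩ := h.exists_split h₁ (by omega)
  have hcard := Finset.card_union_add_card_inter S₁ S'
  rw [hcup] at hcard
  obtain ⟨d, S₂, S₃, ℓ₂, ℓ₃, hc₂, hc₃, hcap', rfl, hlo', hhi'⟩ := hc'.exists_split h₂ (by omega)
  have := Finset.card_union_le S₂ S₃
  have hc := hc₂.necklace.left_mem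
  exact ⟨c, d, S₁, S₂, S₃, ℓ₁, ℓ₂, ℓ₃, hc₁, hc₂, hc₃, by grind, hcap', hlo, hlo', hhi', by omega⟩

end BeadChain

end BeadChain

section Ball

variable {V : Type*} {G : SimpleGraph V} {R A : Finset V}

/-- The vertices within distance `j` of `A` in the subgraph induced by `R`. -/
noncomputable def ball (G : SimpleGraph V) (R A : Finset V) (j : ℕ) : Finset V :=
  R.filter fun v => ∃ a ∈ A, Linked G R j a v

theorem subset_ball (hA : A ⊆ R) (j : ℕ) : A ⊆ ball G R A j :=
  fun a ha => Finset.mem_filter.2 ⟨hA ha, a, ha, .refl (Finset.mem_coe.2 (hA ha))⟩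

theorem ball_mono : Monotone (ball G R A) :=
  fun _ _ hij _ hv =>
    let ⟨hvR, a, ha, h⟩ := Finset.mem_filter.1 hv
    Finset.mem_filter.2 ⟨hvR, a, ha, h.mono_length hij⟩

end Ball

section Expansion

variable {V : Type*} [Fintype V] {G : SimpleGraph V} {δ η : ℝ} {R A B F : Finset V}
  {ρ : ℕ}

/-- Every vertex set of size between `8` and half of the order expands by the factor `δ`. -/
def HasExpansion (G : SimpleGraph V) (δ : ℝ) : Prop :=
  ∀ X : Finset V, 8 ≤ X.card → 2 * X.card ≤ Fintype.card V → δ * X.card ≤ (extNbhd G X).card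

/-- Inside `R`, every superset of `A` of at most half the order of `G` expands by the factor
`η`. -/
def GrowsIn (G : SimpleGraph V) (R : Finset V) (η : ℝ) (A : Finset V) : Prop :=
  ∀ X ⊆ R, A ⊆ X → 2 * X.card ≤ Fintype.card V → η * X.card ≤ (extNbhd G X ∩ R).card

theorem IsExpander.hasExpansion {ε₁ : ℝ} (h : IsExpander G ε₁ 15) (hε : 0 < ε₁) :
    HasExpansion G (ε₁ / Real.log (Fintype.card V) ^ 2) := by
  intro X h8 h2
  have h8' : (8 : ℝ) ≤ X.card := by exact_mod_cast h8
  have h2' : 2 * (X.card : ℝ) ≤ Fintype.card V := by exact_mod_cast h2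
  have hlog : 0 < Real.log (X.card : ℝ) := Real.log_pos (by linarith)
  calc ε₁ / Real.log (Fintype.card V) ^ 2 * X.card
      ≤ ε₁ / Real.log (15 * (X.card : ℝ) / 15) ^ 2 * X.card := by
        rw [mul_div_cancel_left₀ _ (by norm_num)]
        gcongr
        linarith
    _ = expansion ε₁ 15 X.card * X.card := by rw [expansion, if_neg (by linarith)]
    _ ≤ (extNbhd G X).card := h X (by linarith) (by linarith)

theorem GrowsIn.mono (h : GrowsIn G R η A) (hAB : A ⊆ B) : GrowsIn G R η B :=
  fun X hX hBX => h X hX (hAB.trans hBX)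

theorem HasExpansion.growsIn (h : HasExpansion G δ) (hδ : 0 ≤ δ) (hA : 8 ≤ A.card)
    (hF : (F.card : ℝ) ≤ δ / 2 * A.card) : GrowsIn G Fᶜ (δ / 2) A := by
  intro X _ hAX hX
  have hcard := Finset.card_le_card hAX
  have hN := h X (hA.trans hcard) hX
  have hNF : ((extNbhd G X).card : ℝ) ≤ (extNbhd G X ∩ Fᶜ).card + F.card := by
    rw [← Finset.sdiff_eq_inter_compl]
    exact_mod_cast Finset.card_le_card_sdiff_add_card
  have : δ / 2 * A.card ≤ δ / 2 * X.card := by gcongr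
  linarith

theorem extNbhd_ball_inter_subset (j : ℕ) : extNbhd G (ball G R A j) ∩ R ⊆ ball G R A (j + 1) := by
  intro v hv
  obtain ⟨hv, hvR⟩ := Finset.mem_inter.1 hv
  obtain ⟨-, -, u, hu, huv⟩ := Finset.mem_filter.1 hv
  obtain ⟨-, a, ha, h⟩ := Finset.mem_filter.1 hu
  exact Finset.mem_filter.2 ⟨hvR, a, ha, h.trans (.of_adj huv h.right_mem hvR)⟩

theorem disjoint_extNbhd (X : Finset V) : Disjoint X (extNbhd G X) :=
  Finset.disjoint_right.2 fun _ hv => (Finset.mem_filter.1 hv).2.1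

namespace GrowsIn

theorem pow_le_card_ball (h : GrowsIn G R η A) (hη : 0 ≤ η) (hA : A ⊆ R) (hne : A.Nonempty)
    {j : ℕ} (hj : 2 * (ball G R A j).card ≤ Fintype.card V) :
    (1 + η) ^ j ≤ (ball G R A j).card := by
  induction j with
  | zero => simpa using (hne.mono (subset_ball hA 0)).card_pos
  | succ j ih =>
    have hcard := Finset.card_le_card (ball_mono (G := G) (R := R) (A := A) (Nat.le_add_right j 1))
    have hN := h (ball G R A j) (Finset.filter_subset _ _) (subset_ball hA j) (by omega)
    have hunion : (ball G R A j).card + (extNbhd G (ball G R A j) ∩ R).card ≤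
        (ball G R A (j + 1)).card := by
      rw [← Finset.card_union_of_disjoint
        ((disjoint_extNbhd _).mono_right Finset.inter_subset_left)]
      exact Finset.card_le_card
        (Finset.union_subset (ball_mono (Nat.le_add_right j 1)) (extNbhd_ball_inter_subset j))
    calc (1 + η) ^ (j + 1) = (1 + η) * (1 + η) ^ j := by ring
      _ ≤ (1 + η) * (ball G R A j).card := by gcongr; exact ih (by omega)
      _ = (ball G R A j).card + η * (ball G R A j).card := by ring
      _ ≤ (ball G R A j).card + (extNbhd G (ball G R A j) ∩ R).card := by gcongr
      _ ≤ (ball G R A (j + 1)).card := by exact_mod_cast hunion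

theorem card_lt_two_mul_card_ball (h : GrowsIn G R η A) (hη : 0 ≤ η) (hA : A ⊆ R)
    (hne : A.Nonempty) (hρ : (Fintype.card V : ℝ) < (1 + η) ^ ρ) :
    Fintype.card V < 2 * (ball G R A ρ).card := by
  by_contra! hball
  have hpow := h.pow_le_card_ball hη hA hne hball
  have : ((ball G R A ρ).card : ℝ) ≤ Fintype.card V := by exact_mod_cast Finset.card_le_univ _
  linarith

theorem exists_linked (hGA : GrowsIn G R η A) (hGB : GrowsIn G R η B) (hη : 0 ≤ η) (hA : A ⊆ R)
    (hB : B ⊆ R) (hAne : A.Nonempty) (hBne : B.Nonempty)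
    (hρ : (Fintype.card V : ℝ) < (1 + η) ^ ρ) :
    ∃ a ∈ A, ∃ b ∈ B, Linked G R (2 * ρ) a b := by
  have hcardA := hGA.card_lt_two_mul_card_ball hη hA hAne hρ
  have hcardB := hGB.card_lt_two_mul_card_ball hη hB hBne hρ
  have hmeet : ¬ Disjoint (ball G R A ρ) (ball G R B ρ) := fun hd => by
    have := Finset.card_le_univ (ball G R A ρ ∪ ball G R B ρ)
    rw [Finset.card_union_of_disjoint hd] at this
    omega
  obtain ⟨v, hvA, hvB⟩ := Finset.not_disjoint_iff.1 hmeet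
  obtain ⟨-, a, ha, hav⟩ := Finset.mem_filter.1 hvA
  obtain ⟨-, b, hb, hbv⟩ := Finset.mem_filter.1 hvB
  exact ⟨a, ha, b, hb, two_mul ρ ▸ hav.trans hbv.symm⟩

end GrowsIn

theorem HasExpansion.exists_linked (h : HasExpansion G δ) (hδ : 0 ≤ δ)
    (hρ : (Fintype.card V : ℝ) < (1 + δ / 2) ^ ρ) (hA : 8 ≤ A.card) (hB : 8 ≤ B.card)
    (hFA : (F.card : ℝ) ≤ δ / 2 * A.card) (hFB : (F.card : ℝ) ≤ δ / 2 * B.card)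
    (hdA : Disjoint A F) (hdB : Disjoint B F) :
    ∃ a ∈ A, ∃ b ∈ B, Linked G ((F : Set V)ᶜ) (2 * ρ) a b := by
  rw [← Finset.coe_compl]
  exact (h.growsIn hδ hA hFA).exists_linked (h.growsIn hδ hB hFB) (by positivity)
    (Finset.subset_compl_iff_disjoint_right.2 hdA) (Finset.subset_compl_iff_disjoint_right.2 hdB)
    (Finset.card_pos.1 (by omega)) (Finset.card_pos.1 (by omega)) hρ

theorem BeadChain.exists_isWheel {a b : V} {S : Finset V} {ℓ K θ₁ θ₂ : ℕ}
    (hS : BeadChain G K a b S ℓ) (h : HasExpansion G δ) (hδ : 0 ≤ δ)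
    (hρ : (Fintype.card V : ℝ) < (1 + δ / 2) ^ ρ) (h8 : 8 ≤ θ₁) (hK : K + 2 ≤ θ₂)
    (hθ : ((θ₂ + K : ℕ) : ℝ) ≤ δ / 2 * θ₁) (hcard : 2 * (θ₁ + 1) + θ₂ + 2 * K ≤ S.card) :
    ∃ (ℓ' : ℕ) (W : G.Subgraph), IsWheel W ℓ' ∧ θ₂ ≤ ℓ' * K + 1 := by
  obtain ⟨c, d, S₁, S₂, S₃, ℓ₁, ℓ₂, ℓ₃, hS₁, hS₂, hS₃, h₁₂, h₂₃, hc₁, hc₂, hc₂', hc₃⟩ :=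
    hS.exists_split_three (Nat.succ_pos θ₁) (by omega : 1 ≤ θ₂) hcard
  have hA : θ₁ ≤ (S₁ \ S₂).card := by
    have := Finset.card_sdiff_add_card_inter S₁ S₂
    rw [h₁₂, Finset.card_singleton] at this
    omega
  have hB : θ₁ ≤ (S₃ \ S₂).card := by
    have := Finset.card_sdiff_add_card_inter S₃ S₂
    rw [Finset.inter_comm, h₂₃, Finset.card_singleton] at this
    omega
  have hF {X : Finset V} (hX : θ₁ ≤ X.card) : (S₂.card : ℝ) ≤ δ / 2 * X.card :=
    calc (S₂.card : ℝ) ≤ (θ₂ + K : ℕ) := by exact_mod_cast hc₂'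
      _ ≤ δ / 2 * θ₁ := hθ
      _ ≤ δ / 2 * X.card := by gcongr
  obtain ⟨u, hu, v, hv, huv⟩ := h.exists_linked hδ hρ (h8.trans hA) (h8.trans hB) (hF hA) (hF hB)
    Finset.sdiff_disjoint Finset.sdiff_disjoint
  have hℓ₂ := hS₂.card_le
  have hℓ₂' : 2 ≤ ℓ₂ := by
    by_contra! hlt
    have : ℓ₂ * K ≤ 1 * K := Nat.mul_le_mul_right K (by omega)
    omega
  obtain ⟨W, hW⟩ := hS₁.necklace.exists_isWheel_of_bypass hS₂.necklace hS₃.necklace h₁₂ h₂₃ hℓ₂'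
    (Finset.mem_sdiff.1 hu).1 (Finset.mem_sdiff.1 hv).1 huv
  exact ⟨ℓ₂, W, hW, hc₂.trans hℓ₂⟩

end Expansion

section Robust

variable {V : Type*} [Fintype V] {G : SimpleGraph V} {δ η : ℝ} {R A F U X Y : Finset V}

theorem GrowsIn.sdiff (h : GrowsIn G R η A) (hη : 0 ≤ η) (hF : (F.card : ℝ) ≤ η / 2 * A.card) :
    GrowsIn G (R \ F) (η / 2) A := by
  intro X hXR hAX hX
  have hN := h X (hXR.trans Finset.sdiff_subset) hAX hX
  have hNF : ((extNbhd G X ∩ R).card : ℝ) ≤ (extNbhd G X ∩ (R \ F)).card + F.card := by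
    rw [← Finset.inter_sdiff_assoc]
    exact_mod_cast Finset.card_le_card_sdiff_add_card
  have : η / 2 * A.card ≤ η / 2 * X.card := by gcongr
  linarith

theorem extNbhd_empty (G : SimpleGraph V) : extNbhd G ∅ = ∅ :=
  Finset.filter_eq_empty_iff.2 fun _ _ h => by simp at h

theorem extNbhd_union_sdiff_subset (G : SimpleGraph V) (X Y U : Finset V) :
    extNbhd G (X ∪ Y) \ U ⊆ (extNbhd G X \ (Y ∪ U)) ∪ (extNbhd G Y \ U) := by
  intro v
  simp only [extNbhd, Finset.mem_sdiff, Finset.mem_union, Finset.mem_filter]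
  grind

theorem HasExpansion.card_le_of_card_extNbhd_sdiff_le (h : HasExpansion G δ) (hδ : 0 < δ)
    (hX : 2 * X.card ≤ Fintype.card V) (hN : ((extNbhd G X \ U).card : ℝ) ≤ δ / 2 * X.card) :
    (X.card : ℝ) ≤ 2 * U.card / δ + 7 := by
  rcases Nat.lt_or_ge X.card 8 with h8 | h8
  · have : (X.card : ℝ) ≤ 7 := by exact_mod_cast Nat.le_of_lt_succ h8
    have : 0 ≤ 2 * U.card / δ := by positivity
    linarith
  · have hsplit : ((extNbhd G X).card : ℝ) ≤ (extNbhd G X \ U).card + U.card := by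
      exact_mod_cast Finset.card_le_card_sdiff_add_card
    have : (X.card : ℝ) ≤ 2 * U.card / δ := by
      rw [le_div_iff₀ hδ]
      linarith [h X h8 hX]
    linarith

/-- The sets outside `U`, of at most half the order of `G`, that expand by less than the factor
`δ / 2` once `U` is deleted. -/
noncomputable def nonexpanding (G : SimpleGraph V) (U : Finset V) (δ : ℝ) : Finset (Finset V) :=
  Finset.univ.filter fun X =>
    Disjoint X U ∧ 2 * X.card ≤ Fintype.card V ∧ ((extNbhd G X \ U).card : ℝ) ≤ δ / 2 * X.card

theorem HasExpansion.card_nonexpanding_union_le (h : HasExpansion G δ) (hδ : 0 < δ) (hδ₁ : δ ≤ 1)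
    (hn : 112 ≤ δ * Fintype.card V) (hU : (U.card : ℝ) ≤ δ ^ 2 / 48 * Fintype.card V)
    (hY : Y ∈ nonexpanding G U δ) : ((Y ∪ U).card : ℝ) ≤ δ / 8 * Fintype.card V := by
  obtain ⟨hYU, hYn, hYN⟩ := (Finset.mem_filter.1 hY).2
  have hY_card := h.card_le_of_card_extNbhd_sdiff_le hδ hYn hYN
  have hU_div : (U.card : ℝ) / δ ≤ δ / 48 * Fintype.card V := by
    rw [div_le_iff₀ hδ]
    linarith
  have : (U.card : ℝ) ≤ U.card / δ := le_div_self (by positivity) hδ hδ₁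
  rw [Finset.card_union_of_disjoint hYU, Nat.cast_add]
  linarith [mul_div_assoc 2 (U.card : ℝ) δ]

theorem union_mem_nonexpanding (hY : Y ∈ nonexpanding G U δ) (hX : Disjoint X (Y ∪ U))
    (hXY : 2 * (X ∪ Y).card ≤ Fintype.card V)
    (hN : ((extNbhd G X \ (Y ∪ U)).card : ℝ) ≤ δ / 2 * X.card) :
    X ∪ Y ∈ nonexpanding G U δ := by
  obtain ⟨hYU, -, hYN⟩ := (Finset.mem_filter.1 hY).2
  obtain ⟨hdXY, hdXU⟩ := Finset.disjoint_union_right.1 hX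
  refine Finset.mem_filter.2
    ⟨Finset.mem_univ _, Finset.disjoint_union_left.2 ⟨hdXU, hYU⟩, hXY, ?_⟩
  have hcard : (((extNbhd G (X ∪ Y)) \ U).card : ℝ) ≤
      (extNbhd G X \ (Y ∪ U)).card + (extNbhd G Y \ U).card := by
    exact_mod_cast (Finset.card_le_card (extNbhd_union_sdiff_subset G X Y U)).trans
      (Finset.card_union_le _ _)
  rw [Finset.card_union_of_disjoint hdXY, Nat.cast_add]
  linarith

/-- Delete, besides `U`, a largest nonexpanding set: any nonexpanding set of the rest could be
added to it. -/
theorem HasExpansion.exists_growsIn_empty (h : HasExpansion G δ) (hδ : 0 < δ) (hδ₁ : δ ≤ 1)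
    (hn : 112 ≤ δ * Fintype.card V) (hU : (U.card : ℝ) ≤ δ ^ 2 / 48 * Fintype.card V) :
    ∃ R : Finset V, Disjoint R U ∧ Fintype.card V ≤ 2 * R.card ∧ GrowsIn G R (δ / 2) ∅ := by
  have hempty : ∅ ∈ nonexpanding G U δ :=
    Finset.mem_filter.2 ⟨Finset.mem_univ _, by simp [extNbhd_empty]⟩
  obtain ⟨B, hB, hmax⟩ := (nonexpanding G U δ).exists_max_image Finset.card ⟨∅, hempty⟩
  have hBU := h.card_nonexpanding_union_le hδ hδ₁ hn hU hB
  have hδn : δ * Fintype.card V ≤ Fintype.card V := mul_le_of_le_one_left (by positivity) hδ₁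
  refine ⟨(B ∪ U)ᶜ, ?_, ?_, fun X hXR _ hX => ?_⟩
  · exact disjoint_compl_left.mono_right Finset.subset_union_right
  · have hcompl : ((B ∪ U).card : ℝ) + (B ∪ U)ᶜ.card = Fintype.card V := by
      exact_mod_cast Finset.card_add_card_compl _
    have : (Fintype.card V : ℝ) ≤ 2 * (B ∪ U)ᶜ.card := by linarith
    exact_mod_cast this
  rw [← Finset.sdiff_eq_inter_compl]
  by_contra! hN
  have hXBU : Disjoint X (B ∪ U) := disjoint_compl_left.mono_left hXR
  have hXne : 0 < X.card := Nat.pos_of_ne_zero fun h0 => by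
    simp [Finset.card_eq_zero.1 h0, extNbhd_empty] at hN
  have hXB : (X ∪ B).card = X.card + B.card :=
    Finset.card_union_of_disjoint (hXBU.mono_right Finset.subset_union_left)
  by_cases hlarge : 2 * (X ∪ B).card ≤ Fintype.card V
  · have := hmax _ (union_mem_nonexpanding hB hXBU hlarge hN.le)
    omega
  · have hBle : (B.card : ℝ) ≤ (B ∪ U).card := by
      exact_mod_cast Finset.card_le_card Finset.subset_union_left
    have hXge : (Fintype.card V : ℝ) < 2 * (X.card + B.card) := by exact_mod_cast by omega
    have hX8 : (8 : ℝ) ≤ X.card := by linarith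
    have hsplit : ((extNbhd G X).card : ℝ) ≤ (extNbhd G X \ (B ∪ U)).card + (B ∪ U).card := by
      exact_mod_cast Finset.card_le_card_sdiff_add_card
    have hNX := h X (by exact_mod_cast hX8) hX
    have : δ / 2 * (Fintype.card V / 4) ≤ δ / 2 * X.card := by gcongr; linarith
    linarith

end Robust

section LongPath

variable {V : Type*} [Fintype V] {G : SimpleGraph V} {R D : Finset V} {η : ℝ} {x y v : V}

/-- A state of the depth-first search in `R`: the search is finished with the vertices of `D`, and
the path `p` leads from the current vertex `x` back to the root `y`. -/
structure IsSearchState (G : SimpleGraph V) (R D : Finset V) {x y : V} (p : G.Walk x y) :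
    Prop where
  isPath : p.IsPath
  subset : D ⊆ R
  support_subset : ∀ v ∈ p.support, v ∈ R \ D
  extNbhd_subset : ∀ v ∈ extNbhd G D ∩ R, v ∈ p.support

namespace IsSearchState

variable {p : G.Walk x y}

theorem push (h : IsSearchState G R D p) (hvx : G.Adj v x) (hv : v ∈ R \ D)
    (hvp : v ∉ p.support) : IsSearchState G R D (p.cons hvx) where
  isPath := h.isPath.cons hvp
  subset := h.subset
  support_subset := by simpa using ⟨Finset.mem_sdiff.1 hv, by simpa using h.support_subset⟩
  extNbhd_subset u hu := by simp [h.extNbhd_subset u hu]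

theorem restart (hD : D ⊆ R) (hN : extNbhd G D ∩ R = ∅) (hv : v ∈ R \ D) :
    IsSearchState G R D (.nil : G.Walk v v) where
  isPath := .nil
  subset := hD
  support_subset := by simpa using hv
  extNbhd_subset := by simp [hN]

theorem extNbhd_insert_subset (h : IsSearchState G R D p)
    (hx : ∀ v ∈ R \ D, G.Adj v x → v ∈ p.support) :
    ∀ v ∈ extNbhd G (insert x D) ∩ R, v ∈ p.support ∧ v ≠ x := by
  intro v hv
  obtain ⟨hv, hvR⟩ := Finset.mem_inter.1 hv
  obtain ⟨-, hvxD, u, hu, huv⟩ := Finset.mem_filter.1 hv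
  obtain ⟨hvx, hvD⟩ := not_or.1 fun h => hvxD (Finset.mem_insert.2 h)
  refine ⟨?_, hvx⟩
  rcases Finset.mem_insert.1 hu with rfl | hu
  · exact hx v (Finset.mem_sdiff.2 ⟨hvR, hvD⟩) huv.symm
  · exact h.extNbhd_subset v
      (Finset.mem_inter.2 ⟨Finset.mem_filter.2 ⟨Finset.mem_univ v, hvD, u, hu, huv⟩, hvR⟩)

theorem pop (h : IsSearchState G R D p) (hx : ∀ v ∈ R \ D, G.Adj v x → v ∈ p.support)
    (hcard : D.card + 1 < R.card) :
    ∃ (x' y' : V) (p' : G.Walk x' y'), IsSearchState G R (insert x D) p' := by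
  have hsub := h.extNbhd_insert_subset hx
  have hxRD := h.support_subset x p.start_mem_support
  have hDR : insert x D ⊆ R := Finset.insert_subset (Finset.mem_sdiff.1 hxRD).1 h.subset
  cases p with
  | nil =>
    have hN : extNbhd G (insert x D) ∩ R = ∅ :=
      Finset.eq_empty_of_forall_notMem fun v hv => (hsub v hv).2 (by simpa using (hsub v hv).1)
    obtain ⟨v, hv⟩ : (R \ insert x D).Nonempty := by
      rw [← Finset.card_pos, Finset.card_sdiff_of_subset hDR,
        Finset.card_insert_of_notMem (Finset.mem_sdiff.1 hxRD).2]
      omega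
    exact ⟨v, v, .nil, restart hDR hN hv⟩
  | @cons _ z _ hxz q =>
    obtain ⟨hq, hxq⟩ := (SimpleGraph.Walk.cons_isPath_iff hxz q).1 h.isPath
    refine ⟨z, y, q, hq, hDR, fun v hv => ?_, fun v hv => ?_⟩
    · have := Finset.mem_sdiff.1 (h.support_subset v (by simp [hv]))
      have hvx : v ≠ x := fun h => hxq (h ▸ hv)
      simp [this, hvx]
    · simpa [(hsub v hv).2] using (hsub v hv).1

theorem exists_of_card_lt {k : ℕ} (hk : k < R.card) :
    ∃ (D : Finset V) (x y : V) (p : G.Walk x y), IsSearchState G R D p ∧ D.card = k := by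
  induction k with
  | zero =>
    obtain ⟨v, hv⟩ := Finset.card_pos.1 hk
    exact ⟨∅, v, v, .nil, restart (by simp) (by simp [extNbhd_empty]) (by simpa using hv), rfl⟩
  | succ k ih =>
    obtain ⟨D, x₀, y₀, p₀, h₀, rfl⟩ := ih (by omega)
    have hbdd : ∃ m, ∃ (x y : V) (p : G.Walk x y), IsSearchState G R D p ∧
        Fintype.card V - p.length = m := ⟨_, x₀, y₀, p₀, h₀, rfl⟩
    obtain ⟨x, y, p, hp, hlen⟩ := Nat.find_spec hbdd
    have hx : ∀ v ∈ R \ D, G.Adj v x → v ∈ p.support := fun v hv hvx => by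
      by_contra hvp
      have hlt := (hp.push hvx hv hvp).isPath.length_lt
      have hmin := Nat.find_min' hbdd ⟨v, y, _, hp.push hvx hv hvp, rfl⟩
      rw [SimpleGraph.Walk.length_cons] at hlt hmin
      omega
    obtain ⟨x', y', p', hp'⟩ := hp.pop hx hk
    refine ⟨_, x', y', p', hp', Finset.card_insert_of_notMem ?_⟩
    exact (Finset.mem_sdiff.1 (hp.support_subset x p.start_mem_support)).2

end IsSearchState

theorem GrowsIn.exists_isPath (h : GrowsIn G R η ∅) {k : ℕ} (hk : 2 * k ≤ Fintype.card V)
    (hkR : k < R.card) :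
    ∃ (x y : V) (p : G.Walk x y), p.IsPath ∧ (∀ v ∈ p.support, v ∈ R) ∧ η * k ≤ p.length + 1 := by
  obtain ⟨D, x, y, p, hp, rfl⟩ := IsSearchState.exists_of_card_lt (G := G) hkR
  refine ⟨x, y, p, hp.isPath, fun v hv => (Finset.mem_sdiff.1 (hp.support_subset v hv)).1, ?_⟩
  have hcard : (extNbhd G D ∩ R).card ≤ p.support.length :=
    (Finset.card_le_card fun v hv => List.mem_toFinset.2 (hp.extNbhd_subset v hv)).trans
      p.support.toFinset_card_le
  calc η * D.card ≤ (extNbhd G D ∩ R).card := h D hp.subset (Finset.empty_subset D) hk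
    _ ≤ p.length + 1 := by rw [p.length_support] at hcard; exact_mod_cast hcard

end LongPath

section CycleSet

variable {V : Type*} {G : SimpleGraph V} {R : Set V} {x y a b : V} {l : ℕ}

/-- `Q` is the vertex set of a cycle of `G`. -/
def IsCycleSet (G : SimpleGraph V) (Q : Finset V) : Prop :=
  ∃ C : G.Subgraph, IsCycleSubgraph C ∧ (Q : Set V) = C.verts

theorem exists_isCycleSet_of_isPath {p : G.Walk a b} (hp : p.IsPath) (hlen : 2 ≤ p.length)
    (h : Linked G R l b a) (hR : ∀ v ∈ R, v ∈ p.support → v = a ∨ v = b) :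
    ∃ Q : Finset V, IsCycleSet G Q ∧ p.length ≤ Q.card ∧ Q.card ≤ p.length + l + 1 ∧
      ∀ v ∈ Q, v ∈ p.support ∨ v ∈ R := by
  obtain ⟨q, hq, hql, hqR⟩ := h.exists_isPath
  have hdisj : p.support.tail.Disjoint q.support.tail := fun v hvp hvq => by
    have hpa := hp.support_nodup
    have hqb := hq.support_nodup
    rw [← p.cons_tail_support, List.nodup_cons] at hpa
    rw [← q.cons_tail_support, List.nodup_cons] at hqb
    rcases hR v (hqR v (List.mem_of_mem_tail hvq)) (List.mem_of_mem_tail hvp) with rfl | rfl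
    exacts [hpa.1 hvp, hqb.1 hvq]
  refine ⟨(p.append q).support.toFinset,
    ⟨_, ⟨a, p.append q, hp.isCycle_append hq hdisj (.inl hlen), rfl⟩, ?_⟩, ?_, ?_, ?_⟩
  · ext v; simp
  · calc p.length ≤ p.support.toFinset.card := by
          rw [List.toFinset_card_of_nodup hp.support_nodup, p.length_support]; omega
      _ ≤ _ := Finset.card_le_card fun v hv => List.mem_toFinset.2
          ((SimpleGraph.Walk.mem_support_append_iff _ _).2 (.inl (List.mem_toFinset.1 hv)))
  · refine (List.toFinset_card_le _).trans ?_
    rw [SimpleGraph.Walk.length_support, SimpleGraph.Walk.length_append]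
    omega
  · intro v hv
    rcases (SimpleGraph.Walk.mem_support_append_iff _ _).1 (List.mem_toFinset.1 hv) with hv | hv
    exacts [.inl hv, .inr (hqR v hv)]

theorem exists_subpath {p : G.Walk x y} (hp : p.IsPath) {i j : ℕ} (hij : i ≤ j)
    (hj : j ≤ p.length) :
    ∃ q : G.Walk (p.getVert i) (p.getVert j), q.IsPath ∧ q.length = j - i ∧
      ∀ v ∈ q.support, ∃ m ≤ j, p.getVert m = v := by
  have hi : (p.take j).getVert i = p.getVert i := by rw [p.take_getVert, min_eq_right hij]
  refine ⟨((p.take j).drop i).copy hi rfl, ?_, ?_, fun v hv => ?_⟩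
  · simpa using (hp.take j).drop i
  · simp [SimpleGraph.Walk.drop_length, SimpleGraph.Walk.take_length, hj]
  · obtain ⟨m, hm, -⟩ := SimpleGraph.Walk.mem_support_iff_exists_getVert.1 hv
    refine ⟨min j (i + m), min_le_left _ _, ?_⟩
    simpa [SimpleGraph.Walk.drop_getVert, SimpleGraph.Walk.take_getVert] using hm

/-- The vertices of `p` with positions in `[i, j)`. -/
noncomputable def segment (p : G.Walk x y) (i j : ℕ) : Finset V :=
  (Finset.Ico i j).image p.getVert

theorem segment_subset {R : Finset V} {p : G.Walk x y} (hR : ∀ v ∈ p.support, v ∈ R) (i j : ℕ) :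
    segment p i j ⊆ R :=
  Finset.image_subset_iff.2 fun m _ => hR _ (p.getVert_mem_support m)

theorem card_segment {p : G.Walk x y} (hp : p.IsPath) {i j : ℕ} (hj : j ≤ p.length + 1) :
    (segment p i j).card = j - i := by
  rw [segment, Finset.card_image_of_injOn, Nat.card_Ico]
  exact hp.getVert_injOn.mono fun m hm =>
    show m ≤ p.length by have := (Finset.mem_Ico.1 hm).2; omega

theorem disjoint_segment {p : G.Walk x y} (hp : p.IsPath) {i j i' j' : ℕ} (h : j ≤ i')
    (hj : j' ≤ p.length + 1) : Disjoint (segment p i j) (segment p i' j') := by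
  refine Finset.disjoint_left.2 fun v hv hv' => ?_
  obtain ⟨m, hm, rfl⟩ := Finset.mem_image.1 hv
  obtain ⟨m', hm', heq⟩ := Finset.mem_image.1 hv'
  rw [Finset.mem_Ico] at hm hm'
  have := hp.getVert_injOn (show m' ≤ p.length by omega) (show m ≤ p.length by omega) heq
  omega

theorem getVert_mem_segment (p : G.Walk x y) {i j m : ℕ} (hi : i ≤ m) (hj : m < j) :
    p.getVert m ∈ segment p i j :=
  Finset.mem_image_of_mem _ (Finset.mem_Ico.2 ⟨hi, hj⟩)

theorem exists_isCycleSet_of_linked {p s : ℕ} {w : G.Walk x y} (hw : w.IsPath)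
    (hwR : ∀ v ∈ w.support, v ∈ R) (hs : 0 < s) (hlen : 2 * p + s ≤ w.length + 1)
    (ha : a ∈ segment w 0 p) (hb : b ∈ segment w (p + s) (2 * p + s))
    (hab : Linked G (R \ segment w p (p + s)) l a b) :
    ∃ Q : Finset V, IsCycleSet G Q ∧ (∀ v ∈ Q, v ∈ R) ∧ s ≤ Q.card ∧
      Q.card ≤ 2 * p + s + l := by
  obtain ⟨a, ha, b, hb, hab⟩ := hab.exists_crossing (Finset.mem_coe.2 ha) (Finset.mem_coe.2 hb)
  obtain ⟨i, hi, rfl⟩ := Finset.mem_image.1 (Finset.mem_coe.1 ha)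
  obtain ⟨j, hj, rfl⟩ := Finset.mem_image.1 (Finset.mem_coe.1 hb)
  rw [Finset.mem_Ico] at hi hj
  obtain ⟨q, hq, hql, hqw⟩ := exists_subpath hw (show i ≤ j by omega) (by omega)
  have hcover {m : ℕ} (hm : m ≤ j) : w.getVert m ∈ segment w 0 p ∨
      w.getVert m ∈ segment w p (p + s) ∨ w.getVert m ∈ segment w (p + s) (2 * p + s) := by
    rcases Nat.lt_or_ge m p with h₁ | h₁
    · exact .inl (getVert_mem_segment w (Nat.zero_le m) h₁)
    rcases Nat.lt_or_ge m (p + s) with h₂ | h₂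
    · exact .inr (.inl (getVert_mem_segment w h₁ h₂))
    · exact .inr (.inr (getVert_mem_segment w h₂ (by omega)))
  obtain ⟨Q, hQ, hQs, hQM, hQR⟩ := exists_isCycleSet_of_isPath hq (by omega) hab.symm
    fun z hz hzq => by
      obtain ⟨m, hm, rfl⟩ := hqw z hzq
      have := hcover hm
      simp only [Set.mem_insert_iff, Set.mem_sdiff, Finset.mem_coe] at hz
      tauto
  refine ⟨Q, hQ, fun z hz => ?_, by omega, by omega⟩
  rcases hQR z hz with hzq | rfl | rfl | hz
  · obtain ⟨m, -, rfl⟩ := hqw z hzq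
    exact hwR _ (w.getVert_mem_support m)
  · exact hwR _ (w.getVert_mem_support i)
  · exact hwR _ (w.getVert_mem_support j)
  · exact hz.1.1

theorem GrowsIn.exists_isCycleSet [Fintype V] {R : Finset V} {η : ℝ} {ρ p s : ℕ}
    (h : GrowsIn G R η ∅) (hη : 0 ≤ η) (hρ : (Fintype.card V : ℝ) < (1 + η / 2) ^ ρ)
    {w : G.Walk x y} (hw : w.IsPath) (hwR : ∀ v ∈ w.support, v ∈ R) (hp : 0 < p) (hs : 0 < s)
    (hsp : (s : ℝ) ≤ η / 2 * p) (hlen : 2 * p + s ≤ w.length + 1) :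
    ∃ Q : Finset V, IsCycleSet G Q ∧ Q ⊆ R ∧ s ≤ Q.card ∧ Q.card ≤ 2 * p + s + 2 * ρ := by
  set A := segment w 0 p
  set F := segment w p (p + s)
  set B := segment w (p + s) (2 * p + s)
  have hA : A.card = p := card_segment hw (by omega)
  have hB : B.card = p := by rw [card_segment hw hlen]; omega
  have hF : (F.card : ℝ) ≤ η / 2 * p := by rwa [card_segment hw (by omega), Nat.add_sub_cancel_left]
  have hAF : Disjoint A F := disjoint_segment hw le_rfl (by omega)
  have hBF : Disjoint B F := (disjoint_segment hw le_rfl hlen).symm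
  obtain ⟨u, hu, v, hv, huv⟩ :=
    ((h.mono (Finset.empty_subset A)).sdiff hη (hA ▸ hF)).exists_linked
      ((h.mono (Finset.empty_subset B)).sdiff hη (hB ▸ hF)) (by positivity)
      (Finset.subset_sdiff.2 ⟨segment_subset hwR _ _, hAF⟩)
      (Finset.subset_sdiff.2 ⟨segment_subset hwR _ _, hBF⟩)
      (Finset.card_pos.1 (hA ▸ hp)) (Finset.card_pos.1 (hB ▸ hp)) hρ
  rw [Finset.coe_sdiff] at huv
  exact exists_isCycleSet_of_linked hw hwR hs hlen hu hv huv

end CycleSet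

section CycleFamily

variable {V : Type*} [Fintype V] {G : SimpleGraph V} {δ : ℝ} {U : Finset V} {ρ p s M : ℕ}

theorem HasExpansion.exists_isCycleSet (h : HasExpansion G δ) (hδ : 0 < δ) (hδ₁ : δ ≤ 1)
    (hn : 112 ≤ δ * Fintype.card V) (hρ : (Fintype.card V : ℝ) < (1 + δ / 4) ^ ρ) (hp : 0 < p)
    (hs : 0 < s) (hsp : (s : ℝ) ≤ δ / 4 * p)
    (hpn : ((2 * p + s : ℕ) : ℝ) ≤ δ / 8 * Fintype.card V)
    (hU : (U.card : ℝ) ≤ δ ^ 2 / 48 * Fintype.card V) :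
    ∃ Q : Finset V, IsCycleSet G Q ∧ Disjoint Q U ∧ s ≤ Q.card ∧ Q.card ≤ 2 * p + s + 2 * ρ := by
  obtain ⟨R, hRU, hR, hgrow⟩ := h.exists_growsIn_empty hδ hδ₁ hn hU
  have hn' : 112 ≤ Fintype.card V := by
    have : δ * Fintype.card V ≤ Fintype.card V := mul_le_of_le_one_left (by positivity) hδ₁
    exact_mod_cast hn.trans this
  set k := (Fintype.card V - 1) / 2
  obtain ⟨x, y, w, hw, hwR, hlen⟩ :=
    hgrow.exists_isPath (k := k) (by omega) (by omega)
  have hlong : ((2 * p + s : ℕ) : ℝ) ≤ (w.length + 1 : ℕ) :=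
    calc ((2 * p + s : ℕ) : ℝ) ≤ δ / 8 * Fintype.card V := hpn
      _ ≤ δ / 8 * (4 * k : ℕ) := by gcongr; omega
      _ = δ / 2 * k := by push_cast; ring
      _ ≤ (w.length + 1 : ℕ) := by exact_mod_cast hlen
  have hquarter : δ / 2 / 2 = δ / 4 := by ring
  obtain ⟨Q, hQ, hQR, hQs⟩ := hgrow.exists_isCycleSet (by positivity) (hquarter ▸ hρ) hw hwR hp hs
    (hquarter ▸ hsp) (by exact_mod_cast hlong)
  exact ⟨Q, hQ, hRU.mono_left hQR, hQs⟩

/-- A family of pairwise disjoint vertex sets of cycles with sizes between `s` and `M`. -/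
structure IsCycleFamily (G : SimpleGraph V) (s M : ℕ) (𝒞 : Finset (Finset V)) : Prop where
  isCycleSet : ∀ Q ∈ 𝒞, IsCycleSet G Q
  le_card : ∀ Q ∈ 𝒞, s ≤ Q.card
  card_le : ∀ Q ∈ 𝒞, Q.card ≤ M
  pairwiseDisjoint : (𝒞 : Set (Finset V)).PairwiseDisjoint id

theorem HasExpansion.exists_isCycleFamily (h : HasExpansion G δ) (hδ : 0 < δ) (hδ₁ : δ ≤ 1)
    (hn : 112 ≤ δ * Fintype.card V) (hρ : (Fintype.card V : ℝ) < (1 + δ / 4) ^ ρ) (hp : 0 < p)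
    (hs : 0 < s) (hsp : (s : ℝ) ≤ δ / 4 * p)
    (hpn : ((2 * p + s : ℕ) : ℝ) ≤ δ / 8 * Fintype.card V) (hM : 2 * p + s + 2 * ρ ≤ M) :
    ∃ 𝒞, IsCycleFamily G s M 𝒞 ∧ δ ^ 2 / 48 * Fintype.card V ≤ (𝒞.biUnion id).card := by
  have hempty : IsCycleFamily G s M ∅ := ⟨by simp, by simp, by simp, by simp⟩
  obtain ⟨𝒞, h𝒞, hmax⟩ := (Finset.univ.filter (IsCycleFamily G s M)).exists_max_image Finset.card
    ⟨∅, Finset.mem_filter.2 ⟨Finset.mem_univ _, hempty⟩⟩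
  replace h𝒞 := (Finset.mem_filter.1 h𝒞).2
  refine ⟨𝒞, h𝒞, ?_⟩
  by_contra! hU
  obtain ⟨Q, hQ, hQU, hQs, hQM⟩ := h.exists_isCycleSet hδ hδ₁ hn hρ hp hs hsp hpn hU.le
  have hQ_disj : ∀ Q' ∈ 𝒞, Disjoint Q Q' := fun Q' hQ' =>
    hQU.mono_right (Finset.subset_biUnion_of_mem id hQ')
  have hQ𝒞 : Q ∉ 𝒞 := fun hmem => by
    have := Finset.disjoint_self_iff_empty _ |>.1 (hQ_disj Q hmem)
    simp [this] at hQs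
    omega
  have hins : IsCycleFamily G s M (insert Q 𝒞) :=
    ⟨by simpa using ⟨hQ, h𝒞.isCycleSet⟩, by simpa using ⟨hQs, h𝒞.le_card⟩,
      by simpa using ⟨hQM.trans hM, h𝒞.card_le⟩, by
        rw [Finset.coe_insert]
        exact h𝒞.pairwiseDisjoint.insert fun Q' hQ' _ => hQ_disj Q' hQ'⟩
  have := hmax _ (Finset.mem_filter.2 ⟨Finset.mem_univ _, hins⟩)
  rw [Finset.card_insert_of_notMem hQ𝒞] at this
  omega

end CycleFamily

section CycleStack

variable {V : Type*} [Fintype V] {G : SimpleGraph V} {𝒞 : Finset (Finset V)} {l k s M : ℕ}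
  {F E : Finset V}

/-- `CycleStack G 𝒞 l k F E`: a stack of `k` cycles of the family `𝒞`, each linked by a path of
length at most `l` to an earlier exit. Here `F` is the set of all vertices of the cycles and links,
and `E` the set of exits, the vertices of the last cycle from which the next link may start; while
the stack is empty, every vertex is an exit. -/
inductive CycleStack (G : SimpleGraph V) (𝒞 : Finset (Finset V)) (l : ℕ) :
    ℕ → Finset V → Finset V → Prop
  | nil : CycleStack G 𝒞 l 0 ∅ Finset.univ
  | push {k : ℕ} {F E Q L : Finset V} {x y : V} {p : G.Walk x y} :
      CycleStack G 𝒞 l k F E → y ∈ E → Q ∈ 𝒞 → p.IsPath → p.support.toFinset = L →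
      L.card ≤ l + 1 → L ∩ F ⊆ {y} → Disjoint Q F → Q ∩ L = {x} →
      CycleStack G 𝒞 l (k + 1) (F ∪ L ∪ Q) (Q \ {x})

namespace CycleStack

theorem eq_of_height_zero (h : CycleStack G 𝒞 l 0 F E) : F = ∅ ∧ E = Finset.univ := by
  cases h
  exact ⟨rfl, rfl⟩

theorem exits_nonempty [Nonempty V] (h : CycleStack G 𝒞 l k F E) (h𝒞 : ∀ Q ∈ 𝒞, 2 ≤ Q.card) :
    E.Nonempty := by
  cases h with
  | nil => exact Finset.univ_nonempty
  | @push _ _ _ Q _ x _ _ _ _ hQ =>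
    have hcard := Finset.le_card_sdiff {x} Q
    have := h𝒞 Q hQ
    rw [Finset.card_singleton] at hcard
    exact Finset.card_pos.1 (by omega)

theorem exists_beadChain (h : CycleStack G 𝒞 l k F E) (h𝒞 : IsCycleFamily G s M 𝒞) {z : V}
    (hz : z ∈ E) : ∃ a, BeadChain G (M + l) a z (insert z F) k := by
  induction h generalizing z with
  | nil => exact ⟨z, .nil⟩
  | @push k F _ Q L x y p _ hy hQ𝒞 hp hL hLl hLF hQF hQL ih =>
    obtain ⟨a, ha⟩ := ih hy
    obtain ⟨hzQ, hzx⟩ := Finset.mem_sdiff.1 hz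
    obtain ⟨C, hC, hCQ⟩ := h𝒞.isCycleSet Q hQ𝒞
    have hxQ : x ∈ Q := (Finset.mem_inter.1 (hQL ▸ Finset.mem_singleton_self x)).1
    have hyL : y ∈ L := hL ▸ List.mem_toFinset.2 p.end_mem_support
    have hpiece : IsPiece true C x z :=
      ⟨fun h => hzx (Finset.mem_singleton.2 h.symm), hC, hCQ ▸ hxQ, hCQ ▸ hzQ⟩
    have hbead : Necklace G y z (L ∪ Q) 1 := by
      have hlink := Necklace.of_isPath hp
      rw [hL] at hlink
      simpa using hlink.snoc hpiece hCQ (by rw [Finset.inter_comm, hQL])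
    have hcard : (L ∪ Q).card ≤ M + l + 1 := by
      have := h𝒞.card_le Q hQ𝒞
      have := Finset.card_union_le L Q
      omega
    have hinter : insert y F ∩ (L ∪ Q) = {y} := by
      simp only [Finset.ext_iff, Finset.subset_iff, Finset.disjoint_right, Finset.mem_inter,
        Finset.mem_union, Finset.mem_insert, Finset.mem_singleton] at hLF hQF ⊢
      grind
    have hunion : insert z (F ∪ L ∪ Q) = insert y F ∪ (L ∪ Q) := by
      simp only [Finset.ext_iff, Finset.mem_union, Finset.mem_insert]
      grind
    exact ⟨a, hunion ▸ ha.snoc hbead hcard hinter⟩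

end CycleStack

/-- A state of the depth-first search on the cycles of `𝒞`: besides the stack there are the family
`𝒜` of cycles not yet visited, the set `D` of the vertices of the cycles that have left the stack
and the set `T` of the vertices of their links. -/
structure IsCycleSearchState (G : SimpleGraph V) (𝒞 : Finset (Finset V)) (l k : ℕ) (F E : Finset V)
    (𝒜 : Finset (Finset V)) (D T : Finset V) : Prop where
  stack : CycleStack G 𝒞 l k F E
  subset : 𝒜 ⊆ 𝒞
  disjoint : ∀ Q ∈ 𝒜, Disjoint Q F
  card_le : T.card + (l + 1) * (𝒜.card + k) ≤ (l + 1) * 𝒞.card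
  cover : 𝒞.biUnion id ⊆ D ∪ 𝒜.biUnion id ∪ (T ∪ F)
  separated : ∀ u ∈ D, ∀ v ∈ 𝒜.biUnion id, ¬ Linked G ((T ∪ F : Finset V) : Set V)ᶜ l u v

namespace IsCycleSearchState

variable {𝒜 : Finset (Finset V)} {D T : Finset V}

theorem init (G : SimpleGraph V) (𝒞 : Finset (Finset V)) (l : ℕ) :
    IsCycleSearchState G 𝒞 l 0 ∅ Finset.univ 𝒞 ∅ ∅ where
  stack := .nil
  subset := subset_rfl
  disjoint := by simp
  card_le := by simp
  cover := by simp
  separated := by simp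

theorem exists_link {y v : V} (h : IsCycleSearchState G 𝒞 l k F E 𝒜 D T)
    (hv : v ∈ 𝒜.biUnion id) (hyv : Linked G (insert y ((T ∪ F : Finset V) : Set V)ᶜ) l y v) :
    ∃ (x : V) (p : G.Walk x y), p.IsPath ∧ p.support.toFinset.card ≤ l + 1 ∧
      p.support.toFinset ∩ F ⊆ {y} ∧ p.support.toFinset ∩ 𝒜.biUnion id = {x} := by
  obtain ⟨x, hx, hyx⟩ := hyv.exists_first_hit (C := (𝒜.biUnion id : Finset V)) hv
  obtain ⟨p, hp, hpl, hpR⟩ := hyx.symm.exists_isPath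
  obtain ⟨Q, hQ, hxQ⟩ := Finset.mem_biUnion.1 (Finset.mem_coe.1 hx)
  have hxF : x ∉ F := Finset.disjoint_left.1 (h.disjoint Q hQ) hxQ
  refine ⟨x, p, hp, ?_, fun u hu => ?_, Finset.ext fun u => ?_⟩
  · rw [List.toFinset_card_of_nodup hp.support_nodup, p.length_support]
    omega
  · obtain ⟨hup, huF⟩ := Finset.mem_inter.1 hu
    have hur := hpR u (List.mem_toFinset.1 hup)
    rw [Finset.mem_singleton]
    simp only [Set.mem_insert_iff, Set.mem_sdiff, Set.mem_compl_iff, Finset.mem_coe,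
      Finset.mem_union] at hur
    grind
  · rw [Finset.mem_inter, List.mem_toFinset, Finset.mem_singleton]
    refine ⟨fun ⟨hup, hu⟩ => (hpR u hup).resolve_right fun hur => hur.2 hu, ?_⟩
    rintro rfl
    exact ⟨p.start_mem_support, hx⟩

theorem push (h : IsCycleSearchState G 𝒞 l k F E 𝒜 D T)
    (h𝒞 : (𝒞 : Set (Finset V)).PairwiseDisjoint id) {y v : V} (hy : y ∈ E)
    (hv : v ∈ 𝒜.biUnion id) (hyv : Linked G (insert y ((T ∪ F : Finset V) : Set V)ᶜ) l y v) :
    ∃ (F' E' Q : Finset V), Q ∈ 𝒜 ∧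
      IsCycleSearchState G 𝒞 l (k + 1) F' E' (𝒜.erase Q) D T := by
  obtain ⟨x, p, hp, hLcard, hLF, hL⟩ := h.exists_link hv hyv
  set L := p.support.toFinset
  have hx : x ∈ L ∩ 𝒜.biUnion id := hL ▸ Finset.mem_singleton_self x
  obtain ⟨Q, hQ, hxQ⟩ := Finset.mem_biUnion.1 (Finset.mem_inter.1 hx).2
  have hL𝒜 : ∀ Q' ∈ 𝒜, ∀ u ∈ Q', u ∈ L → u = x := fun Q' hQ' u hu huL =>
    Finset.mem_singleton.1
      (hL ▸ Finset.mem_inter.2 ⟨huL, Finset.mem_biUnion.2 ⟨Q', hQ', hu⟩⟩)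
  have hQL : Q ∩ L = {x} := Finset.eq_singleton_iff_unique_mem.2
    ⟨Finset.mem_inter.2 ⟨hxQ, (Finset.mem_inter.1 hx).1⟩,
      fun u hu => hL𝒜 Q hQ u (Finset.mem_inter.1 hu).1 (Finset.mem_inter.1 hu).2⟩
  have hunion : 𝒜.biUnion id = Q ∪ (𝒜.erase Q).biUnion id := by
    conv_lhs => rw [← Finset.insert_erase hQ, Finset.biUnion_insert, id]
  refine ⟨_, _, Q, hQ, h.stack.push hy (h.subset hQ) hp rfl hLcard hLF (h.disjoint Q hQ) hQL,
    (Finset.erase_subset _ _).trans h.subset, fun Q' hQ' => ?_, ?_, ?_, fun u hu v hv hlink => ?_⟩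
  · obtain ⟨hne, hQ'⟩ := Finset.mem_erase.1 hQ'
    have hQQ' : Disjoint Q' Q := h𝒞 (h.subset hQ') (h.subset hQ) hne
    have hQ'L : Disjoint Q' L := Finset.disjoint_left.2 fun u hu huL =>
      Finset.disjoint_left.1 hQQ' hu (hL𝒜 Q' hQ' u hu huL ▸ hxQ)
    exact Finset.disjoint_union_right.2
      ⟨Finset.disjoint_union_right.2 ⟨h.disjoint Q' hQ', hQ'L⟩, hQQ'⟩
  · have := Finset.card_erase_add_one hQ
    rw [← add_assoc, add_right_comm, this]
    exact h.card_le
  · have := h.cover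
    rw [hunion] at this
    refine this.trans fun u => ?_
    simp only [Finset.mem_union]
    tauto
  · refine h.separated u hu v (hunion ▸ Finset.mem_union_right _ hv) (hlink.mono ?_)
    refine Set.compl_subset_compl.2 (Finset.coe_subset.2 ?_)
    exact Finset.union_subset_union_right
      (Finset.subset_union_left.trans Finset.subset_union_left)

theorem pop (h : IsCycleSearchState G 𝒞 l (k + 1) F E 𝒜 D T)
    (hstuck : ∀ y ∈ E, ∀ v ∈ 𝒜.biUnion id,
      ¬ Linked G (insert y ((T ∪ F : Finset V) : Set V)ᶜ) l y v) :
    ∃ (F' E' Q T' : Finset V), Q ∈ 𝒞 ∧ IsCycleSearchState G 𝒞 l k F' E' 𝒜 (D ∪ Q) T' := by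
  obtain ⟨hstack, hsub, hdisj, hcard, hcover, hsep⟩ := h
  cases hstack with
  | @push _ F E Q L x y p hstack hy hQ𝒞 hp hL hLl hLF hQF hQL =>
  have hxL : x ∈ L := (Finset.mem_inter.1 (hQL ▸ Finset.mem_singleton_self x)).2
  have hblocked : ((T ∪ (F ∪ L ∪ Q) : Finset V) : Set V)ᶜ =
      ((T ∪ L ∪ F : Finset V) : Set V)ᶜ \ (Q \ {x} : Finset V) := by
    ext u
    simp only [Set.mem_compl_iff, Set.mem_sdiff, Finset.mem_coe, Finset.mem_union,
      Finset.mem_sdiff, Finset.mem_singleton]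
    grind
  refine ⟨F, E, Q, T ∪ L, hQ𝒞, hstack, hsub, fun Q' hQ' => ?_, ?_, ?_, fun u hu v hv huv => ?_⟩
  · exact (hdisj Q' hQ').mono_right (Finset.subset_union_left.trans Finset.subset_union_left)
  · have := Finset.card_union_le T L
    linarith
  · refine hcover.trans fun u => ?_
    simp only [Finset.mem_union]
    tauto
  · rcases huv.symm.avoids_or_hits (Q \ {x} : Finset V) with hvu | ⟨c, hc, hvc⟩
    · rw [← hblocked] at hvu
      rcases Finset.mem_union.1 hu with hu | hu
      · exact hsep u hu v hv hvu.symm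
      · exact hvu.right_mem (by simp [hu])
    · exact hstuck c hc v hv (hblocked ▸ hvc.symm)

theorem card_biUnion_le (h : IsCycleSearchState G 𝒞 l k F E 𝒜 D T) :
    (𝒞.biUnion id).card ≤
      D.card + (𝒜.biUnion id).card + ((l + 1) * 𝒞.card + F.card) := by
  have hT : T.card ≤ (l + 1) * 𝒞.card := (Nat.le_add_right _ _).trans h.card_le
  calc (𝒞.biUnion id).card ≤ (D ∪ 𝒜.biUnion id ∪ (T ∪ F)).card := Finset.card_le_card h.cover
    _ ≤ (D ∪ 𝒜.biUnion id).card + (T ∪ F).card := Finset.card_union_le _ _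
    _ ≤ D.card + (𝒜.biUnion id).card + (T.card + F.card) :=
      Nat.add_le_add (Finset.card_union_le _ _) (Finset.card_union_le _ _)
    _ ≤ _ := by omega

theorem exists_of_card_lt {θ : ℕ} (h : IsCycleSearchState G 𝒞 l k F E 𝒜 D T)
    (h𝒞 : IsCycleFamily G s M 𝒞) (hθ : θ + (l + 1) * 𝒞.card ≤ (𝒞.biUnion id).card)
    (hD : D.card < θ) :
    ∃ (k : ℕ) (F E : Finset V) (𝒜 : Finset (Finset V)) (D T : Finset V),
      IsCycleSearchState G 𝒞 l k F E 𝒜 D T ∧ θ ≤ D.card ∧ D.card ≤ θ + M := by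
  induction hm : 2 * 𝒜.card + k using Nat.strong_induction_on generalizing k F E 𝒜 D T with
  | _ m ih =>
  by_cases hpush : ∃ y ∈ E, ∃ v ∈ 𝒜.biUnion id,
      Linked G (insert y ((T ∪ F : Finset V) : Set V)ᶜ) l y v
  · obtain ⟨y, hy, v, hv, hyv⟩ := hpush
    obtain ⟨F', E', Q, hQ, h'⟩ := h.push h𝒞.pairwiseDisjoint hy hv hyv
    have := Finset.card_erase_add_one hQ
    exact ih _ (by omega) h' hD rfl
  · push Not at hpush
    obtain - | k := k
    · obtain ⟨hF, hE⟩ := h.stack.eq_of_height_zero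
      have h𝒜 : 𝒜.biUnion id = ∅ := Finset.eq_empty_of_forall_notMem fun v hv =>
        hpush v (hE ▸ Finset.mem_univ v) v hv (.refl (Set.mem_insert v _))
      have := h.card_biUnion_le
      rw [h𝒜, hF, Finset.card_empty] at this
      omega
    obtain ⟨F', E', Q, T', hQ, h'⟩ := h.pop hpush
    have hcard : (D ∪ Q).card ≤ D.card + M :=
      (Finset.card_union_le D Q).trans (Nat.add_le_add_left (h𝒞.card_le Q hQ) _)
    rcases Nat.lt_or_ge (D ∪ Q).card θ with hlt | hge
    · exact ih _ (by omega) h' hlt rfl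
    · exact ⟨k, F', E', 𝒜, D ∪ Q, T', h', hge, by omega⟩

end IsCycleSearchState

theorem HasExpansion.lt_card_of_separates {δ : ℝ} {ρ θ : ℕ} {A B Z : Finset V}
    (h : HasExpansion G δ) (hδ : 0 ≤ δ) (hδ₁ : δ ≤ 1)
    (hρ : (Fintype.card V : ℝ) < (1 + δ / 2) ^ ρ) (hθ : 16 ≤ θ) (hA : θ ≤ A.card)
    (hB : θ ≤ B.card) (hsep : ∀ u ∈ A, ∀ v ∈ B, ¬ Linked G ((Z : Set V)ᶜ) (2 * ρ) u v) :
    δ / 4 * θ < Z.card := by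
  by_contra! hZ
  have hZθ : 4 * Z.card ≤ θ := by
    have : δ / 4 * θ ≤ 1 / 4 * θ := by gcongr
    have : 4 * (Z.card : ℝ) ≤ θ := by linarith
    exact_mod_cast this
  have hcard {X : Finset V} (hX : θ ≤ X.card) : 8 ≤ (X \ Z).card ∧ θ ≤ 2 * (X \ Z).card := by
    have := Finset.le_card_sdiff Z X
    omega
  have hZX {X : Finset V} (hX : θ ≤ X.card) : (Z.card : ℝ) ≤ δ / 2 * (X \ Z).card := by
    have : δ / 4 * θ ≤ δ / 4 * (2 * (X \ Z).card : ℕ) := by gcongr; exact (hcard hX).2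
    push_cast at this
    linarith
  obtain ⟨u, hu, v, hv, huv⟩ := h.exists_linked hδ hρ (hcard hA).1 (hcard hB).1 (hZX hA) (hZX hB)
    Finset.sdiff_disjoint Finset.sdiff_disjoint
  exact hsep u (Finset.mem_sdiff.1 hu).1 v (Finset.mem_sdiff.1 hv).1 huv

theorem HasExpansion.exists_beadChain [Nonempty V] {δ : ℝ} {ρ θ : ℕ} (h : HasExpansion G δ)
    (hδ : 0 ≤ δ) (hδ₁ : δ ≤ 1) (hρ : (Fintype.card V : ℝ) < (1 + δ / 2) ^ ρ)
    (h𝒞 : IsCycleFamily G s M 𝒞) (hs : 2 ≤ s) (hθ : 16 ≤ θ)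
    (h𝒞θ : (((2 * ρ + 1) * 𝒞.card : ℕ) : ℝ) ≤ δ / 8 * θ)
    (hΩ : 3 * θ + M ≤ (𝒞.biUnion id).card) :
    ∃ (a b : V) (S : Finset V) (k : ℕ), BeadChain G (M + 2 * ρ) a b S k ∧ δ / 8 * θ ≤ S.card := by
  have hδθ {m : ℕ} (hm : (m : ℝ) ≤ δ / 8 * θ) : 8 * m ≤ θ := by
    have : δ / 8 * θ ≤ 1 / 8 * θ := by gcongr
    have : 8 * (m : ℝ) ≤ θ := by linarith
    exact_mod_cast this
  have h𝒞θ' := hδθ h𝒞θ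
  obtain ⟨k, F, E, 𝒜, D, T, hstate, hθD, hDθ⟩ :=
    (IsCycleSearchState.init G 𝒞 (2 * ρ)).exists_of_card_lt h𝒞 (θ := θ) (by omega)
      (by rw [Finset.card_empty]; omega)
  obtain ⟨b, hb⟩ := hstate.stack.exits_nonempty fun Q hQ => hs.trans (h𝒞.le_card Q hQ)
  obtain ⟨a, ha⟩ := hstate.stack.exists_beadChain h𝒞 hb
  refine ⟨a, b, _, k, ha,
    le_trans ?_ (Nat.cast_le.2 (Finset.card_le_card (Finset.subset_insert b F)))⟩
  by_contra! hF
  have hFθ := hδθ hF.le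
  have hcard := hstate.card_biUnion_le
  have hsep := h.lt_card_of_separates hδ hδ₁ hρ hθ hθD (by omega) hstate.separated
  have hTF : (T ∪ F).card ≤ (2 * ρ + 1) * 𝒞.card + F.card :=
    (Finset.card_union_le T F).trans
      (Nat.add_le_add_right ((Nat.le_add_right _ _).trans hstate.card_le) _)
  have : ((T ∪ F).card : ℝ) ≤ ((2 * ρ + 1) * 𝒞.card : ℕ) + F.card := by exact_mod_cast hTF
  linarith

end CycleStack

section Parameters

variable {V : Type*} [Fintype V] {G : SimpleGraph V} {δ : ℝ} {ρ p s K : ℕ}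

theorem IsCycleFamily.card_mul_le {V : Type*} {G : SimpleGraph V} {M : ℕ} {𝒞 : Finset (Finset V)}
    (h𝒞 : IsCycleFamily G s M 𝒞) : 𝒞.card * s ≤ (𝒞.biUnion id).card := by
  rw [Finset.card_biUnion h𝒞.pairwiseDisjoint]
  simpa using Finset.card_nsmul_le_sum 𝒞 (fun Q => Q.card) s h𝒞.le_card

theorem HasExpansion.exists_large_beadChain (h : HasExpansion G δ) (hδ : 0 < δ) (hδ₁ : δ ≤ 1)
    (hρ : (Fintype.card V : ℝ) < (1 + δ / 4) ^ ρ) (hs : 64 * (2 * ρ + 1) ≤ δ * s)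
    (hsp : s ≤ δ / 4 * p) (hK : 2 * p + s + 4 * ρ = K)
    (hn : 2 ^ 20 * K ≤ δ ^ 4 * Fintype.card V) :
    ∃ (a b : V) (S : Finset V) (k : ℕ),
      BeadChain G K a b S k ∧ δ ^ 3 * Fintype.card V ≤ 2 ^ 12 * S.card := by
  have hδ_pow {i : ℕ} (hi : i ≤ 4) : 2 ^ 20 * K ≤ δ ^ i * Fintype.card V :=
    hn.trans (by gcongr ?_ * _; exact pow_le_pow_of_le_one hδ.le hδ₁ hi)
  have hδ_one : 2 ^ 20 * K ≤ δ * Fintype.card V := by simpa using hδ_pow (i := 1) (by omega)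
  have hs2 : 2 ≤ s := by
    have hδs : δ * s ≤ s := mul_le_of_le_one_left (by positivity) hδ₁
    have : (2 : ℝ) ≤ s := by linarith [show (0 : ℝ) ≤ ρ from Nat.cast_nonneg _]
    exact_mod_cast this
  have hp : 0 < p := Nat.pos_of_ne_zero fun h0 => by
    rw [h0, Nat.cast_zero, mul_zero] at hsp
    exact absurd (show s ≤ 0 by exact_mod_cast hsp) (by omega)
  have hpsK : ((2 * p + s : ℕ) : ℝ) ≤ K := by exact_mod_cast (show 2 * p + s ≤ K by omega)
  have hK4 : (4 : ℝ) ≤ K := by exact_mod_cast (show 4 ≤ K by omega)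
  obtain ⟨𝒞, h𝒞, hΩ⟩ := h.exists_isCycleFamily hδ hδ₁ (by linarith) hρ hp (by omega) hsp
    (by linarith) le_rfl
  set Ω := (𝒞.biUnion id).card
  have hKΩ : 64 * K ≤ Ω := by
    have : (64 * K : ℝ) ≤ Ω := by linarith [hδ_pow (i := 2) (by omega)]
    exact_mod_cast this
  have hθ : (Ω : ℝ) ≤ 8 * (Ω / 4 : ℕ) := by exact_mod_cast (show Ω ≤ 8 * (Ω / 4) by omega)
  have : Nonempty V := Fintype.card_pos_iff.1 <| Nat.pos_of_ne_zero fun h0 => by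
    rw [h0, Nat.cast_zero, mul_zero] at hδ_one
    linarith
  have h𝒞θ : (((2 * ρ + 1) * 𝒞.card : ℕ) : ℝ) ≤ δ / 8 * (Ω / 4 : ℕ) := by
    have hcard : (𝒞.card * s : ℝ) ≤ Ω := by exact_mod_cast h𝒞.card_mul_le
    push_cast
    linarith [mul_le_mul_of_nonneg_right hs (Nat.cast_nonneg (α := ℝ) 𝒞.card),
      mul_le_mul_of_nonneg_left (hcard.trans hθ) hδ.le]
  obtain ⟨a, b, S, k, hS, hcard⟩ := h.exists_beadChain hδ.le hδ₁
    (hρ.trans_le (by gcongr; norm_num)) h𝒞 hs2 (by omega) h𝒞θ (by omega)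
  rw [show 2 * p + s + 2 * ρ + 2 * ρ = K by omega] at hS
  refine ⟨a, b, S, k, hS, ?_⟩
  linarith [mul_le_mul_of_nonneg_left (hΩ.trans hθ) hδ.le]

theorem BeadChain.exists_isWheel_of_large {a b : V} {S : Finset V} {k : ℕ}
    (hS : BeadChain G K a b S k) (h : HasExpansion G δ) (hδ : 0 < δ) (hδ₁ : δ ≤ 1)
    (hρ : (Fintype.card V : ℝ) < (1 + δ / 2) ^ ρ) (hK : 2 ≤ K)
    (hcard : 2 ^ 8 * K ≤ δ * S.card) :
    ∃ (ℓ : ℕ) (W : G.Subgraph), IsWheel W ℓ ∧ δ * S.card ≤ 2 ^ 7 * (ℓ * K) := by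
  set θ₂ := ⌊δ * S.card / 32⌋₊
  have hle : (θ₂ : ℝ) ≤ δ * S.card / 32 := Nat.floor_le (by positivity)
  have hlt : δ * S.card / 32 < θ₂ + 1 := Nat.lt_floor_add_one _
  have hδS : δ * S.card ≤ S.card := mul_le_of_le_one_left (by positivity) hδ₁
  have hKS : 256 * K ≤ S.card := by exact_mod_cast (show 256 * (K : ℝ) ≤ S.card by linarith)
  have hKθ₂ : 8 * K < θ₂ + 1 := by exact_mod_cast (show 8 * (K : ℝ) < θ₂ + 1 by linarith)
  have hθ₂S : 32 * θ₂ ≤ S.card := by exact_mod_cast (show 32 * (θ₂ : ℝ) ≤ S.card by linarith)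
  have hθ₁ : (S.card : ℝ) ≤ 8 * (S.card / 4 : ℕ) := by
    exact_mod_cast (show S.card ≤ 8 * (S.card / 4) by omega)
  obtain ⟨ℓ, W, hW, hℓ⟩ := hS.exists_isWheel h hδ.le hρ (θ₁ := S.card / 4) (θ₂ := θ₂) (by omega)
    (by omega) (by push_cast; linarith [mul_le_mul_of_nonneg_left hθ₁ hδ.le]) (by omega)
  have hθ₂ℓ : (θ₂ + 1 : ℝ) ≤ 4 * (ℓ * K) := by
    exact_mod_cast (show θ₂ + 1 ≤ 4 * (ℓ * K) by omega)
  exact ⟨ℓ, W, hW, by linarith⟩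

theorem exists_lt_one_add_pow (hδ : 0 < δ) (hδ₁ : δ ≤ 1) {n : ℕ} (hn : 3 ≤ n) :
    ∃ t m : ℕ, (n : ℝ) < (1 + δ / 4) ^ (t * m) ∧ 8 ≤ δ * t ∧ δ * t ≤ 9 ∧ 1 ≤ m ∧
      (m : ℝ) ≤ 2 * Real.log n := by
  have hn0 : (0 : ℝ) < n := by positivity
  have hlog : 1 ≤ Real.log n := by
    rw [Real.le_log_iff_exp_le hn0]
    linarith [Real.exp_one_lt_d9, show (3 : ℝ) ≤ n by exact_mod_cast hn]
  have hm := Nat.le_ceil (Real.log n)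
  have hm' := Nat.ceil_lt_add_one (zero_le_one.trans hlog)
  have hm1 : 1 ≤ ⌈Real.log n⌉₊ := Nat.one_le_ceil_iff.2 (by linarith)
  have ht := Nat.le_ceil (8 / δ)
  have ht' := Nat.ceil_lt_add_one (show 0 ≤ 8 / δ by positivity)
  set t := ⌈8 / δ⌉₊
  set m := ⌈Real.log n⌉₊
  rw [div_le_iff₀' hδ] at ht
  have hbase : (3 : ℝ) ≤ (1 + δ / 4) ^ t :=
    calc (3 : ℝ) ≤ 1 + t * (δ / 4) := by linarith
      _ ≤ (1 + δ / 4) ^ t := one_add_mul_le_pow (by linarith) t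
  refine ⟨t, m, ?_, ht, ?_, hm1, by linarith⟩
  · calc (n : ℝ) ≤ Real.exp m := (Real.log_le_iff_le_exp hn0).1 hm
      _ = Real.exp 1 ^ m := by rw [← Real.exp_nat_mul, mul_one]
      _ < 3 ^ m :=
        pow_lt_pow_left₀ (by linarith [Real.exp_one_lt_d9]) (Real.exp_pos 1).le (by omega)
      _ ≤ ((1 + δ / 4) ^ t) ^ m := by gcongr
      _ = (1 + δ / 4) ^ (t * m) := (pow_mul _ _ _).symm
  · calc δ * t ≤ δ * (8 / δ + 1) := by gcongr
      _ = 8 + δ := by field_simp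
      _ ≤ 9 := by linarith

theorem exists_cycle_lengths {t m : ℕ} (hδ : 0 < δ) (ht : 8 ≤ δ * t) (ht' : δ * t ≤ 9)
    (hm : 1 ≤ m) : ∃ s p K : ℕ, 64 * (2 * (t * m : ℕ) + 1) ≤ δ * s ∧ s ≤ δ / 4 * p ∧
      2 * p + s + 4 * (t * m) = K ∧ 2 ≤ K ∧ δ ^ 3 * K ≤ 2 ^ 16 * m := by
  have ht1 : 1 ≤ t := Nat.pos_of_ne_zero fun h0 => by
    rw [h0, Nat.cast_zero, mul_zero] at ht
    linarith
  have htm : 1 ≤ t * m := Nat.mul_pos ht1 hm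
  obtain ⟨s, hs⟩ : ∃ s, s = 8 * t * (2 * (t * m) + 1) := ⟨_, rfl⟩
  obtain ⟨K, hK⟩ : ∃ K, 2 * (t * s) + s + 4 * (t * m) = K := ⟨_, rfl⟩
  have hst : s ≤ t * s := Nat.le_mul_of_pos_left s ht1
  have hs_le : s ≤ 24 * (t ^ 2 * m) :=
    calc s ≤ 8 * t * (2 * (t * m) + t * m) := by rw [hs]; gcongr
      _ = 24 * (t ^ 2 * m) := by ring
  have hK_le : K ≤ 76 * (t ^ 3 * m) :=
    calc K ≤ 3 * (t * s) + 4 * (t * m) := by omega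
      _ ≤ 3 * (t * (24 * (t ^ 2 * m))) + 4 * (t ^ 3 * m) := by
        gcongr
        exact Nat.le_self_pow (by omega) t
      _ = 76 * (t ^ 3 * m) := by ring
  refine ⟨s, t * s, K, ?_, ?_, hK, by omega, ?_⟩
  · rw [hs]
    push_cast
    linarith [mul_le_mul_of_nonneg_right ht (show 0 ≤ (2 * (t * m) + 1 : ℝ) by positivity)]
  · push_cast
    linarith [mul_le_mul_of_nonneg_right ht (Nat.cast_nonneg (α := ℝ) s)]
  · calc δ ^ 3 * K ≤ δ ^ 3 * (76 * (t ^ 3 * m)) := by gcongr; exact_mod_cast hK_le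
      _ = 76 * ((δ * t) ^ 3 * m) := by ring
      _ ≤ 76 * (9 ^ 3 * m) := by gcongr
      _ ≤ 2 ^ 16 * m := by linarith [show (0 : ℝ) ≤ m from Nat.cast_nonneg m]

theorem HasExpansion.exists_large_isWheel (h : HasExpansion G δ) (hδ : 0 < δ) (hδ₁ : δ ≤ 1)
    (hcard : 3 ≤ Fintype.card V)
    (hn : 2 ^ 37 * Real.log (Fintype.card V) ≤ δ ^ 7 * Fintype.card V) :
    ∃ (ℓ : ℕ) (W : G.Subgraph), IsWheel W ℓ ∧
      δ ^ 7 * Fintype.card V ≤ 2 ^ 36 * (Real.log (Fintype.card V) * ℓ) := by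
  obtain ⟨t, m, hρ, ht, ht', hm, hm_log⟩ := exists_lt_one_add_pow hδ hδ₁ hcard
  obtain ⟨s, p, K, hs, hsp, hK, hK₂, hKm⟩ := exists_cycle_lengths hδ ht ht' hm
  have hK_log : δ ^ 3 * K ≤ 2 ^ 17 * Real.log (Fintype.card V) := by linarith
  have hKn : 2 ^ 20 * K ≤ δ ^ 4 * Fintype.card V :=
    le_of_mul_le_mul_left (by linarith) (show 0 < δ ^ 3 by positivity)
  obtain ⟨a, b, S, k, hS, hScard⟩ := h.exists_large_beadChain hδ hδ₁ hρ hs hsp hK hKn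
  have hδS : δ ^ 4 * Fintype.card V ≤ 2 ^ 12 * (δ * S.card) := by
    linarith [mul_le_mul_of_nonneg_left hScard hδ.le]
  obtain ⟨ℓ, W, hW, hℓ⟩ := hS.exists_isWheel_of_large h hδ hδ₁
    (hρ.trans_le (by gcongr; norm_num)) hK₂ (by linarith)
  refine ⟨ℓ, W, hW, ?_⟩
  calc δ ^ 7 * Fintype.card V = δ ^ 3 * (δ ^ 4 * Fintype.card V) := by ring
    _ ≤ δ ^ 3 * (2 ^ 12 * (δ * S.card)) := by gcongr
    _ ≤ δ ^ 3 * (2 ^ 12 * (2 ^ 7 * (ℓ * K))) := by gcongr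
    _ = 2 ^ 19 * (δ ^ 3 * K) * ℓ := by ring
    _ ≤ 2 ^ 19 * (2 ^ 17 * Real.log (Fintype.card V)) * ℓ := by gcongr
    _ = 2 ^ 36 * (Real.log (Fintype.card V) * ℓ) := by ring

theorem eventually_log_bounds {ε : ℝ} (hε : 0 < ε) : ∃ n₀ : ℕ, ∀ n ≥ n₀,
    3 ≤ n ∧ ε ≤ Real.log n ^ 2 ∧ ε ^ 9 ≤ Real.log n ∧
      2 ^ 37 * Real.log n ^ 15 ≤ ε ^ 7 * n := by
  have hlog := Real.tendsto_log_atTop.comp (tendsto_natCast_atTop_atTop (R := ℝ))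
  have hpow := ((Real.isLittleO_pow_log_id_atTop (n := 15)).comp_tendsto
    (tendsto_natCast_atTop_atTop (R := ℝ))).bound (show 0 < ε ^ 7 / 2 ^ 37 by positivity)
  refine Filter.eventually_atTop.1 ?_
  filter_upwards [Filter.eventually_ge_atTop 3, hlog.eventually_ge_atTop (ε + 1),
    hlog.eventually_ge_atTop (ε ^ 9), hpow] with n hn hε₁ hε₉ hn₁₅
  simp only [Function.comp, id, Real.norm_eq_abs] at hε₁ hε₉ hn₁₅
  rw [abs_of_nonneg (by positivity), Nat.abs_cast, div_mul_eq_mul_div,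
    le_div_iff₀' (by positivity)] at hn₁₅
  exact ⟨hn, by nlinarith, hε₉, hn₁₅⟩

end Parameters

end SublinearExpander

theorem lemma2p7_general (ε₁ : ℝ) (hpos : 0 < ε₁) :
    ∃ n₀ : ℕ, ∀ (n : ℕ), n₀ ≤ n →
      ∀ (V : Type*) [Fintype V] (H : SimpleGraph V), Fintype.card V = n →
        SublinearExpander.IsExpander H ε₁ 15 →
        ∃ (ℓ : ℕ) (W : H.Subgraph), SublinearExpander.IsWheel W ℓ ∧
          (ε₁ / 20) ^ 16 * (2 * (n : ℝ) / Real.log (n : ℝ) ^ 16) ≤ (ℓ : ℝ) := by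
  obtain ⟨n₀, hn₀⟩ := SublinearExpander.eventually_log_bounds hpos
  refine ⟨n₀, fun n hn V _ H hV hH => ?_⟩
  obtain ⟨hn₃, hδ₁, hε₉, hn₁₅⟩ := hn₀ n hn
  subst hV
  set n : ℝ := (Fintype.card V : ℝ)
  set L := Real.log n
  have hL : 0 < L := (pow_pos hpos 9).trans_le hε₉
  have hδn : 2 ^ 37 * L ≤ (ε₁ / L ^ 2) ^ 7 * n := by
    rw [div_pow, div_mul_eq_mul_div, le_div_iff₀ (by positivity)]
    linarith
  obtain ⟨ℓ, W, hW, hℓ⟩ := (hH.hasExpansion hpos).exists_large_isWheel (by positivity)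
    ((div_le_one (by positivity)).2 hδ₁) hn₃ hδn
  refine ⟨ℓ, W, hW, ?_⟩
  calc (ε₁ / 20) ^ 16 * (2 * n / L ^ 16)
      = 2 / 20 ^ 16 * (ε₁ ^ 9 * (ε₁ / L ^ 2) ^ 7 * n) / L ^ 2 := by field_simp
    _ ≤ 2 / 20 ^ 16 * (L * (2 ^ 36 * (L * ℓ))) / L ^ 2 := by
      rw [mul_assoc (ε₁ ^ 9)]
      gcongr
    _ = 2 ^ 37 / 20 ^ 16 * ℓ := by field_simp
    _ ≤ ℓ := mul_le_of_le_one_left (Nat.cast_nonneg ℓ) (by norm_num)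

theorem lemma2p7 (ε₁ : ℝ) (hpos : 0 < ε₁) (hlt : ε₁ < 1) :
    ∃ n₀ : ℕ, ∀ (n : ℕ), n₀ ≤ n →
      ∀ (V : Type*) [Fintype V] (H : SimpleGraph V), Fintype.card V = n →
        SublinearExpander.IsExpander H ε₁ 15 →
        ∃ (ℓ : ℕ) (W : H.Subgraph), SublinearExpander.IsWheel W ℓ ∧
          (ε₁ / 20) ^ 16 * (2 * (n : ℝ) / Real.log (n : ℝ) ^ 16) ≤ (ℓ : ℝ) :=
  lemma2p7_general ε₁ hpos
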